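/- Let $\mathcal H_2(\mathbb C)$ be the set of Hermitian complex $2\times 2$ matrices; write $A^*$ for the conjugate transpose and $\bar A$ for the entrywise complex conjugate of $A$. For $A\in\mathcal H_2(\mathbb C)$ let $\mathrm{In}(A)\in\{0,1,2\}$ be the inertia of $A$, i.e. the number of positive eigenvalues of $A$ counted with multiplicity, and for invertible $A$ put $\eta(A)=-1$ if $A$ is negative definite and $\eta(A)=1$ if $A$ is positive definite or indefinite. Let $\Phi:\mathcal H_2(\mathbb C)\to\mathcal H_2(\mathbb C)$ be a map. Then $\Phi(ABA)=\Phi(A)\Phi(B)\Phi(A)$ holds for all $A,B\in\mathcal H_2(\mathbb C)$ if and only if there is a unitary matrix $U\in\mathcal M_2(\mathbb C)$ such that $\Phi$ has one of the following forms: (i) $\Phi(A)=U\begin{bmatrix}\varphi_1(A)&0\\0&\varphi_2(A)\end{bmatrix}U^*$ for all $A$, where $\varphi_1,\varphi_2:\mathcal H_2(\mathbb C)\to\mathbb R$ satisfy $\varphi_i(ABA)=\varphi_i(A)\varphi_i(B)\varphi_i(A)$ for all $A,B$ and have the form $\varphi_i(A)=\psi_i(|\det A|)\,\eta_i(\mathrm{In}(A))$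 with multiplicative functions $\psi_i:[0,\infty)\to\mathbb C$ (that is, $\psi_i(xy)=\psi_i(x)\psi_i(y)$) and maps $\eta_i:\{0,1,2\}\to\{-1,1\}$; (ii) $\Phi(A)=UAU^*$ for all $A$, or $\Phi(A)=-UAU^*$ for all $A$; (iii) $\Phi(A)=U\bar AU^*=UA^TU^*$ for all $A$, or $\Phi(A)=-U\bar AU^*=-UA^TU^*$ for all $A$; (iv) $\Phi(A)=0$ whenever $\operatorname{rank}A\le 1$, and $\Phi(A)=\varepsilon\,\beta(\det A)\,U\widetilde\Phi(A)U^*$ whenever $\operatorname{rank}A=2$, where $\varepsilon\in\{-1,1\}$ is a constant, $\beta:\mathbb R^*\to\mathbb R^*$ is multiplicative with $\beta(1)=1$ (here $\mathbb R^*=\mathbb R\setminus\{0\}$), and $\widetilde\Phi$ is one of the eight maps $A$, $\bar A$, $A^{-1}$, $\bar A^{-1}$, $\eta(A)A$, $\eta(A)\bar A$, $\eta(A)A^{-1}$, $\eta(A)\bar A^{-1}$ (the same one for all $A$). -/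

import Mathlib

open scoped NNReal Matrix

noncomputable section

namespace JordanTriple

/-- The set of Hermitian complex `2 × 2` matrices. -/
abbrev H2 : Type := {A : Matrix (Fin 2) (Fin 2) ℂ // A.IsHermitian}

/-- The Jordan triple product `A B A` of Hermitian matrices. -/
def triple (A B : H2) : H2 :=
  ⟨A.1 * B.1 * A.1, by
    have hA : A.1ᴴ = A.1 := A.2
    have hB : B.1ᴴ = B.1 := B.2
    change (A.1 * B.1 * A.1)ᴴ = A.1 * B.1 * A.1
    rw [Matrix.conjTranspose_mul, Matrix.conjTranspose_mul, hA, hB, Matrix.mul_assoc]⟩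

/-- `Φ(ABA) = Φ(A) Φ(B) Φ(A)` for all `A, B`, for maps between Hermitian matrices. -/
def IsJTPHom (Φ : H2 → H2) : Prop :=
  ∀ A B : H2, Φ (triple A B) = triple (Φ A) (Φ B)

/-- `φ(ABA) = φ(A) φ(B) φ(A)` for all `A, B`, for real valued maps. -/
def IsRealJTPHom (φ : H2 → ℝ) : Prop :=
  ∀ A B : H2, φ (triple A B) = φ A * φ B * φ A

/-- The inertia of `A`: the number of positive eigenvalues, counted with multiplicity. -/
def inertia (A : H2) : Fin 3 :=
  ⟨Nat.card {i : Fin 2 // 0 < A.2.eigenvalues i}, by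
    have h := Nat.card_le_card_of_injective
      (Subtype.val : {i : Fin 2 // 0 < A.2.eigenvalues i} → Fin 2) Subtype.val_injective
    rw [Nat.card_eq_fintype_card (α := Fin 2), Fintype.card_fin] at h
    omega⟩

/-- The determinant of a Hermitian matrix, as a real number. -/
def rdet (A : H2) : ℝ := A.1.det.re

theorem coe_rdet (A : H2) : (rdet A : ℂ) = A.1.det := by
  have hA : A.1ᴴ = A.1 := A.2
  have h : star A.1.det = A.1.det := by rw [← Matrix.det_conjTranspose, hA]
  exact Complex.conj_eq_iff_re.mp h

theorem rdet_ne_zero (A : H2) (h : A.1.rank = 2) : rdet A ≠ 0 := by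
  intro h0
  have hd : A.1.det = 0 := by rw [← coe_rdet, h0, Complex.ofReal_zero]
  obtain ⟨v, hv, hv0⟩ := Matrix.exists_mulVec_eq_zero_iff.mpr hd
  have hn := A.1.mulVecLin.finrank_range_add_finrank_ker
  have hr : Module.finrank ℂ (LinearMap.range A.1.mulVecLin) = 2 := h
  rw [hr, Module.finrank_fin_fun] at hn
  have hk : LinearMap.ker A.1.mulVecLin = ⊥ :=
    Submodule.finrank_eq_zero.mp (by omega)
  exact hv ((LinearMap.ker_eq_bot'.mp hk) v hv0)

/-- The determinant of a Hermitian matrix of rank two, as a nonzero real number. -/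
def detUnit (A : H2) (h : A.1.rank = 2) : ℝˣ := Units.mk0 (rdet A) (rdet_ne_zero A h)

/-- The entrywise complex conjugate of a matrix. -/
def bar (M : Matrix (Fin 2) (Fin 2) ℂ) : Matrix (Fin 2) (Fin 2) ℂ := M.map (starRingEnd ℂ)

open scoped ComplexOrder Classical in
/-- The sign `η(A)`: it is `-1` if `A` is negative definite and `1` otherwise. -/
def eta (A : H2) : ℤˣ := if (-A.1).PosDef then -1 else 1

/-- The sign `ε ∈ {-1, 1}` as a complex number. -/
def sgn (ε : ℤˣ) : ℂ := ((ε : ℤ) : ℂ)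

/-- `φ` is a J.T.P. homomorphism of the form `φ(A) = ψ(|det A|) η(inertia A)`, with
`ψ : [0, ∞) → ℂ` multiplicative and `η : {0, 1, 2} → {-1, 1}`. -/
def IsScalarForm (φ : H2 → ℝ) : Prop :=
  IsRealJTPHom φ ∧
    ∃ (ψ : ℝ≥0 →ₙ* ℂ) (η : Fin 3 → ℤˣ),
      ∀ A : H2, (φ A : ℂ) = ψ ‖A.1.det‖₊ * sgn (η (inertia A))

/-- Form (i): `Φ(A) = U diag(φ₁(A), φ₂(A)) U*`. -/
def FormI (Φ : H2 → H2) (U : Matrix (Fin 2) (Fin 2) ℂ) : Prop :=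
  ∃ φ₁ φ₂ : H2 → ℝ, IsScalarForm φ₁ ∧ IsScalarForm φ₂ ∧
    ∀ A : H2, (Φ A).1 = U * !![(φ₁ A : ℂ), 0; 0, (φ₂ A : ℂ)] * Uᴴ

/-- Form (ii): `Φ(A) = ± U A U*`. -/
def FormII (Φ : H2 → H2) (U : Matrix (Fin 2) (Fin 2) ℂ) : Prop :=
  ∃ ε : ℤˣ, ∀ A : H2, (Φ A).1 = sgn ε • (U * A.1 * Uᴴ)

/-- Form (iii): `Φ(A) = ± U Ā U* = ± U Aᵀ U*`. -/
def FormIII (Φ : H2 → H2) (U : Matrix (Fin 2) (Fin 2) ℂ) : Prop :=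
  ∃ ε : ℤˣ, ∀ A : H2,
    (Φ A).1 = sgn ε • (U * bar A.1 * Uᴴ) ∧ (Φ A).1 = sgn ε • (U * A.1ᵀ * Uᴴ)

/-- The eight maps allowed as `Φ̃` in form (iv), each used on matrices of rank two only. -/
inductive IsTildeForm : (H2 → Matrix (Fin 2) (Fin 2) ℂ) → Prop
  | id : IsTildeForm fun A => A.1
  | conj : IsTildeForm fun A => bar A.1
  | inv : IsTildeForm fun A => A.1⁻¹
  | conjInv : IsTildeForm fun A => (bar A.1)⁻¹
  | etaId : IsTildeForm fun A => sgn (eta A) • A.1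
  | etaConj : IsTildeForm fun A => sgn (eta A) • bar A.1
  | etaInv : IsTildeForm fun A => sgn (eta A) • A.1⁻¹
  | etaConjInv : IsTildeForm fun A => sgn (eta A) • (bar A.1)⁻¹

/-- Form (iv): `Φ(A) = ± β(det A) U Φ̃(A) U*` if `A` has rank two and `Φ(A) = 0` otherwise, with
`β : ℝ* → ℝ*` unital and multiplicative. -/
def FormIV (Φ : H2 → H2) (U : Matrix (Fin 2) (Fin 2) ℂ) : Prop :=
  ∃ (ε : ℤˣ) (β : ℝˣ →* ℝˣ) (T : H2 → Matrix (Fin 2) (Fin 2) ℂ), IsTildeForm T ∧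
    (∀ (A : H2) (h : A.1.rank = 2),
      (Φ A).1 = (sgn ε * (((β (detUnit A h) : ℝˣ) : ℝ) : ℂ)) • (U * T A * Uᴴ)) ∧
    (∀ A : H2, A.1.rank ≤ 1 → (Φ A).1 = 0)

end JordanTriple

end

/-! In Pauli coordinates a Hermitian matrix is a pair (a, u) in ℝ ⊕ ℝ³ with eigenvalues a ± ‖u‖ and
determinant a² - ‖u‖², and conjugation by a unit vector is a half-turn. The problem becomes one of
spherical and hyperbolic geometry.

The image of 1 is a tripotent. If it is not ±1, all values lie in a plane spanned by 1 and one unit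
vector (`HasAxis`). Whenever they do, diagonalising along that vector gives form (i), and
`isScalarForm` describes the two entries. Otherwise Φ is unital and nonaxial after a change of sign.
Such a Φ preserves positivity, sends unit vectors to unit vectors (`map_unit`) and keeps determinant
one on positive elements (`sdet_map`).

The positive elements of determinant one form hyperbolic space. In polar coordinates Φ replaces the
hyperbolic cosine c by `F c` and the direction n by `axis Φ n`; the scalar part of ABA gives a law
of cosines (`exists_cosine_law`). It makes F multiplicative and compatible with w ↦ 2w - 1, so F is
constant or the identity. A constant F would put all directions on one line (`not_trivial`); F = id
makes the action on directions an isometry, up to sign (`exists_isometry`).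

Every element is SKS with S positive and K equal to 1, -1 or a unit vector (`exists_psd_conj`). So
on invertible elements Φ is an isometry up to a multiplicative function of |det| and two signs. If Φ
kills rank-one projections this is form (iv); otherwise function and signs are trivial. By
`exists_unitary` the isometry comes from a unitary, possibly with complex conjugation. The inverse
maps in (iv) need no case of their own: the inverse of (a, u) is (a, -u) divided by the determinant,
and u ↦ -u is an isometry. -/

noncomputable section

/-! ### The spin factor and its triple product -/

namespace SpinFactor

open scoped RealInnerProductSpace

/-- Real three-dimensional Euclidean space. -/
abbrev E3 : Type := EuclideanSpace ℝ (Fin 3)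

/-- The determinant form of the spin factor `ℝ ⊕ ℝ³`. -/
def sdet (A : ℝ × E3) : ℝ := A.1 ^ 2 - ‖A.2‖ ^ 2

/-- The Jordan triple product `A B A` of the spin factor `ℝ ⊕ ℝ³`. -/
def tp (A B : ℝ × E3) : ℝ × E3 :=
  (2 * (A.1 * B.1 + ⟪A.2, B.2⟫) * A.1 - sdet A * B.1,
    (2 * (A.1 * B.1 + ⟪A.2, B.2⟫)) • A.2 + sdet A • B.2)

theorem sdet_tp (A B : ℝ × E3) : sdet (tp A B) = sdet A ^ 2 * sdet B := by
  obtain ⟨a, u⟩ := A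
  obtain ⟨b, v⟩ := B
  simp only [tp, sdet]
  rw [norm_add_sq_real, inner_smul_left, inner_smul_right, norm_smul, norm_smul, mul_pow, mul_pow,
    Real.norm_eq_abs, Real.norm_eq_abs, sq_abs, sq_abs]
  simp only [conj_trivial]
  ring

theorem tp_one (A : ℝ × E3) : tp A (1, 0) = (A.1 ^ 2 + ‖A.2‖ ^ 2, (2 * A.1) • A.2) := by
  simp only [tp, sdet, inner_zero_right, smul_zero, add_zero, mul_one]
  ext1
  · simp only; ring
  · rfl

/-- Elements with a common axis commute; the product has eigenvalues (a ± l)²(b ± m), and the two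
entries are their half sum and half difference. -/
theorem tp_axis {n : E3} (hn : ‖n‖ = 1) (a l b m : ℝ) :
    tp (a, l • n) (b, m • n) =
      (a ^ 2 * b + 2 * a * l * m + l ^ 2 * b, (2 * a * b * l + l ^ 2 * m + a ^ 2 * m) • n) := by
  simp only [tp, sdet, inner_smul_left, inner_smul_right, norm_smul, mul_pow, Real.norm_eq_abs,
    sq_abs, conj_trivial, real_inner_self_eq_norm_sq, hn]
  ext1
  · simp only; ring
  · simp only; module

theorem tp_real (a : ℝ) (B : ℝ × E3) : tp (a, 0) B = (a ^ 2 * B.1, a ^ 2 • B.2) := by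
  simp only [tp, sdet, inner_zero_left, norm_zero, smul_zero, zero_add]
  ext1
  · simp only; ring
  · simp only; module

theorem tp_unit {n : E3} (hn : ‖n‖ = 1) (B : ℝ × E3) :
    tp (0, n) B = (B.1, (2 * ⟪n, B.2⟫) • n - B.2) := by
  simp only [tp, sdet, hn]
  ext1
  · simp only; ring
  · simp only; module

/-- With `n = 0` this also serves as a source of unit vectors. -/
theorem exists_perp (n : E3) : ∃ m : E3, ‖m‖ = 1 ∧ ⟪n, m⟫ = 0 := by
  obtain ⟨v, hv, hv0⟩ : ∃ v : E3, ⟪n, v⟫ = 0 ∧ v ≠ 0 := by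
    by_cases h : n 0 = 0
    · refine ⟨!₂[1, 0, 0], ?_, ?_⟩
      · simp [PiLp.inner_apply, Fin.sum_univ_three, h]
      · intro h0
        have := congrArg (fun w : E3 => w 0) h0
        simp at this
    · refine ⟨!₂[-n 1, n 0, 0], ?_, ?_⟩
      · simp [PiLp.inner_apply, Fin.sum_univ_three]
        ring
      · intro h0
        have := congrArg (fun w : E3 => w 1) h0
        simp [h] at this
  refine ⟨(‖v‖⁻¹) • v, ?_, ?_⟩
  · rw [norm_smul, norm_inv, norm_norm, inv_mul_cancel₀ (norm_ne_zero_iff.mpr hv0)]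
  · rw [inner_smul_right, hv, mul_zero]

theorem exists_axis (u : E3) : ∃ n : E3, ‖n‖ = 1 ∧ u = ‖u‖ • n := by
  by_cases h : u = 0
  · obtain ⟨m, hm, -⟩ := exists_perp 0
    exact ⟨m, hm, by simp [h]⟩
  · have h' : ‖u‖ ≠ 0 := norm_ne_zero_iff.mpr h
    refine ⟨‖u‖⁻¹ • u, ?_, ?_⟩
    · rw [norm_smul, norm_inv, norm_norm, inv_mul_cancel₀ h']
    · rw [smul_smul, mul_inv_cancel₀ h', one_smul]

/-- The half-turn about a suitable axis carries one unit vector to another. -/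
theorem exists_halfturn {n m : E3} (hn : ‖n‖ = 1) (hm : ‖m‖ = 1) :
    ∃ k : E3, ‖k‖ = 1 ∧ (2 * ⟪k, n⟫) • k - n = m := by
  by_cases h : n + m = 0
  · obtain ⟨k, hk, hnk⟩ := exists_perp n
    refine ⟨k, hk, ?_⟩
    rw [real_inner_comm, hnk, mul_zero, zero_smul, zero_sub]
    exact neg_eq_of_add_eq_zero_right h
  · have h' : ‖n + m‖ ≠ 0 := norm_ne_zero_iff.mpr h
    -- The axis bisects the angle; antipodal vectors, treated above, have no bisector but any
    -- perpendicular axis works.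
    refine ⟨‖n + m‖⁻¹ • (n + m), ?_, ?_⟩
    · rw [norm_smul, norm_inv, norm_norm, inv_mul_cancel₀ h']
    · have h2 : ‖n + m‖ ^ 2 = 2 * (1 + ⟪n, m⟫) := by
        rw [norm_add_sq_real, hn, hm]; ring
      have h3 : ⟪n + m, n⟫ = 1 + ⟪n, m⟫ := by
        rw [inner_add_left, real_inner_self_eq_norm_sq, hn, real_inner_comm]; ring
      rw [inner_smul_left, h3, smul_smul, conj_trivial]
      have h4 : 2 * (‖n + m‖⁻¹ * (1 + ⟪n, m⟫)) * ‖n + m‖⁻¹ = 1 := by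
        field_simp
        linarith
      rw [h4]
      module

/-- Linear dependence of two vectors, as equality in the Cauchy–Schwarz inequality. -/
def Par (u v : E3) : Prop := ⟪u, v⟫ ^ 2 = ‖u‖ ^ 2 * ‖v‖ ^ 2

theorem Par.symm {u v : E3} (h : Par u v) : Par v u := by
  unfold Par at *
  rw [real_inner_comm, h, mul_comm]

theorem Par.exists_smul {u v : E3} (h : Par u v) (hu : u ≠ 0) : ∃ c : ℝ, v = c • u := by
  have hu' : ‖u‖ ^ 2 ≠ 0 := pow_ne_zero _ (norm_ne_zero_iff.mpr hu)
  refine ⟨⟪u, v⟫ / ‖u‖ ^ 2, ?_⟩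
  rw [← sub_eq_zero, ← norm_eq_zero, ← sq_eq_zero_iff, norm_sub_sq_real, inner_smul_right,
    norm_smul, mul_pow, Real.norm_eq_abs, sq_abs, real_inner_comm]
  unfold Par at h
  rw [real_inner_comm u v]
  field_simp
  linear_combination (-1) * h

/-- Square roots of positive elements, in polar coordinates. -/
theorem exists_sq_axis {a l : ℝ} (h : |l| ≤ a) : ∃ α β : ℝ, |β| ≤ α ∧ α ^ 2 + β ^ 2 = a ∧
    2 * α * β = l := by
  obtain ⟨h1, h2⟩ := abs_le.mp h
  have hx := Real.sq_sqrt (show 0 ≤ a + l by linarith)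
  have hy := Real.sq_sqrt (show 0 ≤ a - l by linarith)
  have hx0 := Real.sqrt_nonneg (a + l)
  have hy0 := Real.sqrt_nonneg (a - l)
  -- The numbers α ± β are the square roots of the eigenvalues a ± l.
  refine ⟨(√(a + l) + √(a - l)) / 2, (√(a + l) - √(a - l)) / 2, abs_le.mpr ⟨?_, ?_⟩, ?_, ?_⟩
  · linarith
  · linarith
  · linear_combination (1 / 2) * hx + (1 / 2) * hy
  · linear_combination (1 / 2) * hx - (1 / 2) * hy

/-- Every element is `S K S` with `S` positive, where `K` is `1`, `-1` or a unit vector commuting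
with `S`. -/
theorem exists_psd_conj (A : ℝ × E3) : ∃ n : E3, ‖n‖ = 1 ∧ A.2 = ‖A.2‖ • n ∧
    ∃ α β : ℝ, |β| ≤ α ∧ ∃ K : ℝ × E3,
    ((‖A.2‖ ≤ A.1 ∧ K = (1, 0)) ∨ (A.1 ≤ -‖A.2‖ ∧ K = (-1, 0)) ∨
      (|A.1| < ‖A.2‖ ∧ K = (0, n))) ∧
    A = tp (α, β • n) K := by
  obtain ⟨a, u⟩ := A
  obtain ⟨n, hn, hu⟩ := exists_axis u
  refine ⟨n, hn, hu, ?_⟩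
  have hl := norm_nonneg u
  set l := ‖u‖
  clear_value l
  subst hu
  by_cases h1 : l ≤ a
  · obtain ⟨α, β, h, h2, h3⟩ := exists_sq_axis (abs_le.mpr ⟨by linarith, h1⟩ : |l| ≤ a)
    refine ⟨α, β, h, (1, 0), Or.inl ⟨h1, rfl⟩, ?_⟩
    have := tp_axis hn α β 1 0
    rw [zero_smul] at this
    rw [this]
    ext1
    · simp only; linarith
    · simp only; congr 1; linarith
  by_cases h2 : a ≤ -l
  · obtain ⟨α, β, h, h3, h4⟩ := exists_sq_axis (abs_le.mpr ⟨by linarith, by linarith⟩ : |-l| ≤ -a)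
    refine ⟨α, β, h, (-1, 0), Or.inr (Or.inl ⟨h2, rfl⟩), ?_⟩
    have := tp_axis hn α β (-1) 0
    rw [zero_smul] at this
    rw [this]
    ext1
    · simp only; linarith
    · simp only; congr 1; linarith
  · push Not at h1 h2
    obtain ⟨α, β, h, h3, h4⟩ := exists_sq_axis (abs_le.mpr ⟨by linarith, by linarith⟩ : |a| ≤ l)
    refine ⟨α, β, h, (0, n), Or.inr (Or.inr ⟨abs_lt.mpr ⟨by linarith, h1⟩, rfl⟩), ?_⟩
    have := tp_axis hn α β 0 1
    rw [one_smul] at this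
    rw [this]
    ext1
    · simp only; linarith
    · simp only; congr 1; linarith

/-! ### Homomorphisms and the image of the unit -/

/-- A map of the spin factor preserving the Jordan triple product. -/
def IsHom (Φ : ℝ × E3 → ℝ × E3) : Prop := ∀ A B, Φ (tp A B) = tp (Φ A) (Φ B)

/-- The values of `Φ` lie in a plane spanned by `1` and one unit vector. -/
def HasAxis (Φ : ℝ × E3 → ℝ × E3) : Prop := ∃ e : E3, ‖e‖ = 1 ∧ ∀ A, ∃ c : ℝ, (Φ A).2 = c • e

/-- The spanning vector may have any length and may even vanish. -/
theorem hasAxis_of_span {Φ : ℝ × E3 → ℝ × E3} {e : E3}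
    (h : ∀ A, ∃ c : ℝ, (Φ A).2 = c • e) : HasAxis Φ := by
  obtain ⟨n, hn, hen⟩ := exists_axis e
  refine ⟨n, hn, fun A => ?_⟩
  obtain ⟨c, hc⟩ := h A
  exact ⟨c * ‖e‖, by rw [hc, mul_smul, ← hen]⟩

/-- If the image of the unit is not scalar, then it commutes with the whole image. -/
theorem IsHom.hasAxis_or_scalar {Φ : ℝ × E3 → ℝ × E3} (hΦ : IsHom Φ) :
    HasAxis Φ ∨ Φ (1, 0) = (1, 0) ∨ Φ (1, 0) = (-1, 0) := by
  have h3 : tp (Φ (1, 0)) (Φ (1, 0)) = Φ (1, 0) := by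
    rw [← hΦ, tp_real]; simp
  have h1 : ∀ A, tp (Φ (1, 0)) (Φ A) = Φ A := fun A => by
    rw [← hΦ, tp_real]; simp
  generalize Φ (1, 0) = T at h3 h1 ⊢
  obtain ⟨t, ξ⟩ := T
  by_cases hξ : ξ = 0
  · subst hξ
    rw [tp_real] at h3
    have ht : t ^ 2 * t = t := congrArg Prod.fst h3
    have ht' : t * ((t - 1) * (t + 1)) = 0 := by linear_combination ht
    rcases mul_eq_zero.mp ht' with h | h
    · left
      obtain ⟨m, hm, -⟩ := exists_perp 0
      refine ⟨m, hm, fun A => ⟨0, ?_⟩⟩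
      rw [← h1 A, tp_real, h]; simp
    · right
      rcases mul_eq_zero.mp h with h | h
      · left; rw [show t = 1 by linarith]
      · right; rw [show t = -1 by linarith]
  · left
    refine hasAxis_of_span (e := ξ) fun A => ?_
    have hA := congrArg Prod.snd (h1 A)
    have e1 : 2 * (t * t + ‖ξ‖ ^ 2) * t - (t ^ 2 - ‖ξ‖ ^ 2) * t = t := by
      have := congrArg Prod.fst h3
      simpa [tp, sdet] using this
    have e2 : (2 * (t * t + ‖ξ‖ ^ 2) + (t ^ 2 - ‖ξ‖ ^ 2) - 1) • ξ = 0 := by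
      have := congrArg Prod.snd h3
      simp only [tp, sdet, real_inner_self_eq_norm_sq] at this
      rw [sub_smul, add_smul, one_smul, this, sub_self]
    have e3 := (smul_eq_zero.mp e2).resolve_right hξ
    simp only [tp] at hA
    -- By `e3`, 3t² + ‖ξ‖² = 1; determinant one would then give ‖ξ‖² = -1/2.
    have hd : sdet (t, ξ) ≠ 1 := by
      simp only [sdet]
      intro hd
      have : 0 < ‖ξ‖ ^ 2 := by positivity
      nlinarith
    -- The vector part of T Φ(A) T = Φ(A), solved for that of Φ(A), is a multiple of ξ.
    refine ⟨(2 * (t * (Φ A).1 + ⟪ξ, (Φ A).2⟫)) / (1 - sdet (t, ξ)), ?_⟩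
    have hd' : 1 - sdet (t, ξ) ≠ 0 := sub_ne_zero.mpr (Ne.symm hd)
    have e4 : (1 - sdet (t, ξ)) • (Φ A).2 = (2 * (t * (Φ A).1 + ⟪ξ, (Φ A).2⟫)) • ξ := by
      rw [sub_smul, one_smul, sub_eq_iff_eq_add]
      exact hA.symm
    rw [div_eq_inv_mul, mul_smul, ← e4, smul_smul, inv_mul_cancel₀ hd', one_smul]

end SpinFactor

end

/-! ### Nonaxial homomorphisms: positivity, commutation, unit vectors -/

noncomputable section

namespace SpinFactor

open scoped RealInnerProductSpace

theorem tp_scalar (X : ℝ × E3) (c : ℝ) :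
    tp X (c, 0) = (c * (tp X (1, 0)).1, c • (tp X (1, 0)).2) := by
  simp only [tp, inner_zero_right, smul_zero, add_zero, mul_one]
  ext1
  · simp only; ring
  · simp only; module

theorem involution_cases {X : ℝ × E3} (h : tp X (1, 0) = (1, 0)) :
    X = (1, 0) ∨ X = (-1, 0) ∨ (X.1 = 0 ∧ ‖X.2‖ = 1) := by
  obtain ⟨x, ξ⟩ := X
  rw [tp_one] at h
  have h1 : x ^ 2 + ‖ξ‖ ^ 2 = 1 := congrArg Prod.fst h
  have h2 : (2 * x) • ξ = 0 := congrArg Prod.snd h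
  rcases smul_eq_zero.mp h2 with h3 | h3
  · right; right
    have hx : x = 0 := by linarith
    refine ⟨hx, ?_⟩
    rw [hx] at h1
    have : ‖ξ‖ ^ 2 = 1 := by linarith
    exact (pow_eq_one_iff_of_nonneg (norm_nonneg ξ) two_ne_zero).mp this
  · subst h3
    rw [norm_zero] at h1
    rcases sq_eq_sq_iff_eq_or_eq_neg.mp (by linarith : x ^ 2 = 1 ^ 2) with h | h
    · left; rw [h]
    · right; left; rw [h]

theorem sdet_axis {n : E3} (hn : ‖n‖ = 1) (a l : ℝ) : sdet (a, l • n) = a ^ 2 - l ^ 2 := by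
  simp only [sdet, norm_smul, hn, Real.norm_eq_abs, sq_abs, mul_one]

/-- A unital Jordan triple homomorphism whose image is not commutative. -/
structure IsNonaxialHom (Φ : ℝ × E3 → ℝ × E3) : Prop where
  map_tp : IsHom Φ
  map_one : Φ (1, 0) = (1, 0)
  not_hasAxis : ¬ HasAxis Φ

namespace IsNonaxialHom

variable {Φ : ℝ × E3 → ℝ × E3}

theorem map_sq_one (hΦ : IsNonaxialHom Φ) (A : ℝ × E3) :
    Φ (tp A (1, 0)) = tp (Φ A) (1, 0) := by
  rw [hΦ.map_tp, hΦ.map_one]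

/-- Positive elements are exactly the squares A 1 A, and a unital homomorphism preserves squares. -/
theorem map_psd (hΦ : IsNonaxialHom Φ) {n : E3} (hn : ‖n‖ = 1) {a l : ℝ} (h : |l| ≤ a) :
    ‖(Φ (a, l • n)).2‖ ≤ (Φ (a, l • n)).1 := by
  obtain ⟨α, β, -, h2, h3⟩ := exists_sq_axis h
  have hA : (a, l • n) = tp (α, β • n) (1, 0) := by
    rw [tp_one, ← h2, ← h3, norm_smul, hn, mul_one, Real.norm_eq_abs, sq_abs, smul_smul]
  rw [hA, hΦ.map_sq_one, tp_one]
  generalize Φ (α, β • n) = X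
  simp only
  rw [norm_smul, Real.norm_eq_abs, abs_mul, abs_two]
  have := sq_nonneg (|X.1| - ‖X.2‖)
  have h4 := sq_abs X.1
  nlinarith

/-- If `A` is positive and commutes with `B`, then `Φ A` commutes with `Φ B`. -/
theorem map_par (hΦ : IsNonaxialHom Φ) {n : E3} (hn : ‖n‖ = 1) {a l : ℝ} (h : |l| ≤ a)
    (b m : ℝ) : Par (Φ (a, l • n)).2 (Φ (b, m • n)).2 := by
  have hpsd := hΦ.map_psd hn h
  -- Commutation enters as AB²A = BA²B. This identity alone is too weak, as two orthogonal unit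
  -- vectors satisfy it; paired with the vector part of Φ(A), it gives the scalar part of Φ(A) times
  -- the Cauchy–Schwarz defect.
  have hc : tp (a, l • n) (tp (b, m • n) (1, 0)) = tp (b, m • n) (tp (a, l • n) (1, 0)) := by
    have h0 : ((1 : ℝ), (0 : E3)) = (1, (0 : ℝ) • n) := by rw [zero_smul]
    rw [h0, tp_axis hn, tp_axis hn, tp_axis hn, tp_axis hn]
    ext1
    · simp only; ring
    · simp only; congr 1; ring
  have hc' := congrArg Φ hc
  rw [hΦ.map_tp _ (tp _ _), hΦ.map_tp _ (tp _ _), hΦ.map_sq_one, hΦ.map_sq_one, tp_one, tp_one] at hc'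
  generalize Φ (a, l • n) = X at *
  generalize Φ (b, m • n) = Y at *
  have h1 := congrArg (fun Z : ℝ × E3 => ⟪X.2, Z.2⟫) hc'
  simp only [tp, sdet, inner_add_right, inner_smul_right, real_inner_self_eq_norm_sq] at h1
  rw [real_inner_comm X.2 Y.2] at h1
  have h2 : X.1 * (⟪X.2, Y.2⟫ ^ 2 - ‖X.2‖ ^ 2 * ‖Y.2‖ ^ 2) = 0 := by
    linear_combination (-1 / 4) * h1
  rcases mul_eq_zero.mp h2 with h3 | h3
  -- A positive element with zero scalar part vanishes.
  · have h4 : X.2 = 0 := by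
      rw [h3] at hpsd
      exact norm_le_zero_iff.mp hpsd
    rw [Par, h4]; simp
  · exact sub_eq_zero.mp h3

/-- A nonnegative scalar commutes with everything, so a nonzero vector part of its image would be an
axis for Φ. -/
theorem map_real_snd (hΦ : IsNonaxialHom Φ) {a : ℝ} (ha : 0 ≤ a) : (Φ (a, 0)).2 = 0 := by
  by_contra h
  refine hΦ.not_hasAxis (hasAxis_of_span (e := (Φ (a, 0)).2) fun A => ?_)
  obtain ⟨n, hn, hu⟩ := exists_axis A.2
  have := hΦ.map_par hn (a := a) (l := 0) (by simpa using ha) A.1 ‖A.2‖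
  rw [zero_smul, ← hu] at this
  exact this.exists_smul h

theorem map_real (hΦ : IsNonaxialHom Φ) {a : ℝ} (ha : 0 ≤ a) : Φ (a, 0) = ((Φ (a, 0)).1, 0) := by
  ext1
  · rfl
  · exact hΦ.map_real_snd ha

theorem real_fst_nonneg (hΦ : IsNonaxialHom Φ) {a : ℝ} (ha : 0 ≤ a) : 0 ≤ (Φ (a, 0)).1 := by
  obtain ⟨n, hn, -⟩ := exists_axis 0
  have := hΦ.map_psd hn (a := a) (l := 0) (by simpa using ha)
  rw [zero_smul] at this
  exact (norm_nonneg _).trans this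

/-- Scaling by a positive real number. -/
theorem map_smul (hΦ : IsNonaxialHom Φ) {a : ℝ} (ha : 0 ≤ a) (A : ℝ × E3) :
    Φ (a • A) = (Φ (a, 0)).1 • Φ A := by
  have h : ∀ B : ℝ × E3, a • B = tp (√a, 0) B := fun B => by
    rw [tp_real, Real.sq_sqrt ha]; rfl
  have h1 : (a, (0 : E3)) = a • ((1 : ℝ), (0 : E3)) := by simp
  rw [h1, h, h, hΦ.map_tp, hΦ.map_tp, hΦ.map_real (Real.sqrt_nonneg a), hΦ.map_one, tp_real,
    tp_real]
  simp
  rfl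

theorem real_fst_mul (hΦ : IsNonaxialHom Φ) {a b : ℝ} (ha : 0 ≤ a) :
    (Φ (a * b, 0)).1 = (Φ (a, 0)).1 * (Φ (b, 0)).1 := by
  have := hΦ.map_smul ha (b, 0)
  simpa using congrArg Prod.fst this

/-- Since 0A0 = 0, a nonzero scalar Φ(0) would force every Φ(A) to be scalar. -/
theorem map_zero (hΦ : IsNonaxialHom Φ) : Φ (0, 0) = (0, 0) := by
  have h0 := hΦ.map_real le_rfl
  generalize (Φ (0, 0)).1 = z at h0
  have h1 : ∀ A, Φ (0, 0) = (z ^ 2 * (Φ A).1, z ^ 2 • (Φ A).2) := fun A => by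
    rw [← tp_real, ← h0, ← hΦ.map_tp, tp_real]; simp
  by_cases hz : z = 0
  · rw [h0, hz]
  · exfalso
    obtain ⟨m, hm, -⟩ := exists_perp 0
    refine hΦ.not_hasAxis ⟨m, hm, fun A => ⟨0, ?_⟩⟩
    have h2 := congrArg Prod.snd (h1 A)
    rw [h0] at h2
    rw [zero_smul]
    exact (smul_eq_zero.mp h2.symm).resolve_left (pow_ne_zero _ hz)

/-- The span of 1 and `e` is closed under the triple product, so by the decomposition SKS an axis
need only be tested on positive elements, unit vectors and -1. -/
theorem not_span (hΦ : IsNonaxialHom Φ) {e : E3}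
    (h1 : ∀ n : E3, ‖n‖ = 1 → ∀ a l : ℝ, |l| ≤ a → ∃ c : ℝ, (Φ (a, l • n)).2 = c • e)
    (h2 : ∀ n : E3, ‖n‖ = 1 → ∃ c : ℝ, (Φ (0, n)).2 = c • e)
    (h3 : ∃ c : ℝ, (Φ (-1, 0)).2 = c • e) : False := by
  refine hΦ.not_hasAxis (hasAxis_of_span (e := e) fun A => ?_)
  obtain ⟨n, hn, -, α, β, hαβ, K, hK, hA⟩ := exists_psd_conj A
  have hK' : ∃ c : ℝ, (Φ K).2 = c • e := by
    rcases hK with ⟨-, rfl⟩ | ⟨-, rfl⟩ | ⟨-, rfl⟩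
    · exact ⟨0, by rw [hΦ.map_one, zero_smul]⟩
    · exact h3
    · exact h2 n hn
  obtain ⟨c, hc⟩ := hK'
  obtain ⟨d, hd⟩ := h1 n hn α β hαβ
  rw [hA, hΦ.map_tp]
  generalize Φ K = Y at *
  generalize Φ (α, β • n) = X at *
  simp only [tp]
  refine ⟨2 * (X.1 * Y.1 + ⟪X.2, Y.2⟫) * d + sdet X * c, ?_⟩
  rw [add_smul, mul_smul _ d, mul_smul _ c, ← hc, ← hd]

theorem involution (hΦ : IsNonaxialHom Φ) {X : ℝ × E3} (h : tp X (1, 0) = (1, 0)) :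
    tp (Φ X) (1, 0) = (1, 0) := by
  rw [← hΦ.map_sq_one, h, hΦ.map_one]

/-- Otherwise Φ(-1) is a unit vector spanning an axis: positive elements commute with -1, and J(-1)J
= -1 for a unit vector J says that the half-turn about Φ(J) fixes Φ(-1). -/
theorem map_neg_one (hΦ : IsNonaxialHom Φ) : Φ (-1, 0) = (1, 0) ∨ Φ (-1, 0) = (-1, 0) := by
  have hN : tp (Φ (-1, 0)) (1, 0) = (1, 0) := hΦ.involution (by rw [tp_real]; simp)
  rcases involution_cases hN with h | h | ⟨h0, h1⟩
  · exact Or.inl h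
  · exact Or.inr h
  exfalso
  have hne : (Φ (-1, 0)).2 ≠ 0 := by
    intro h; rw [h, norm_zero] at h1; exact zero_ne_one h1
  refine hΦ.not_span (e := (Φ (-1, 0)).2) (fun n hn a l hl => ?_) (fun n hn => ?_)
    ⟨1, (one_smul _ _).symm⟩
  · have := hΦ.map_par hn hl (-1) 0
    rw [zero_smul] at this
    exact this.symm.exists_smul hne
  · have hJ : tp (Φ (0, n)) (1, 0) = (1, 0) := by
      refine hΦ.involution ?_
      rw [tp_unit hn]; simp
    have hJN : tp (Φ (0, n)) (Φ (-1, 0)) = Φ (-1, 0) := by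
      rw [← hΦ.map_tp, tp_unit hn]; simp
    rcases involution_cases hJ with h | h | ⟨h2, h3⟩
    · exact ⟨0, by rw [h, zero_smul]⟩
    · exact ⟨0, by rw [h, zero_smul]⟩
    · generalize Φ (0, n) = X at *
      generalize Φ (-1, 0) = Y at *
      obtain ⟨x, ξ⟩ := X
      simp only at h2 h3
      subst h2
      rw [tp_unit h3] at hJN
      have h4 : (2 * ⟪ξ, Y.2⟫) • ξ - Y.2 = Y.2 := congrArg Prod.snd hJN
      have h5 : Y.2 = ⟪ξ, Y.2⟫ • ξ := by
        have : (2 : ℝ) • Y.2 = (2 : ℝ) • (⟪ξ, Y.2⟫ • ξ) := by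
          rw [smul_smul, sub_eq_iff_eq_add.mp h4, two_smul]
        exact smul_right_injective E3 (two_ne_zero (α := ℝ)) this
      have h6 : ⟪ξ, Y.2⟫ ≠ 0 := fun h => hne (by rw [h5, h, zero_smul])
      refine ⟨⟪ξ, Y.2⟫⁻¹, ?_⟩
      simp only
      nth_rewrite 2 [h5]
      rw [smul_smul, inv_mul_cancel₀ h6, one_smul]

/-- Half-turns move any unit vector to any other, so if one has a scalar image, all have the same
one. The images of positive elements then do not depend on the axis, hence share a line, and Φ is
axial. -/
theorem map_unit (hΦ : IsNonaxialHom Φ) {n : E3} (hn : ‖n‖ = 1) :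
    (Φ (0, n)).1 = 0 ∧ ‖(Φ (0, n)).2‖ = 1 := by
  have hJ : ∀ n : E3, ‖n‖ = 1 → tp (Φ (0, n)) (1, 0) = (1, 0) := fun n hn => by
    refine hΦ.involution ?_
    rw [tp_unit hn]; simp
  by_contra hcon
  obtain ⟨ε, hε, hεn⟩ : ∃ ε : ℝ, ε ^ 2 = 1 ∧ Φ (0, n) = (ε, 0) := by
    rcases involution_cases (hJ n hn) with h | h | h
    · exact ⟨1, by norm_num, h⟩
    · exact ⟨-1, by norm_num, h⟩
    · exact absurd h hcon
  have hall : ∀ m : E3, ‖m‖ = 1 → Φ (0, m) = (ε, 0) := fun m hm => by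
    obtain ⟨k, hk, hkm⟩ := exists_halfturn hn hm
    have : (0, m) = tp (0, k) (0, n) := by rw [tp_unit hk, hkm]
    rw [this, hΦ.map_tp, hεn, tp_scalar, hJ k hk]
    simp
  have hrot : ∀ m k : E3, ‖m‖ = 1 → ‖k‖ = 1 → ∀ a l : ℝ, Φ (a, l • m) = Φ (a, l • k) := by
    intro m k hm hk a l
    obtain ⟨j, hj, hjm⟩ := exists_halfturn hm hk
    have : (a, l • k) = tp (0, j) (a, l • m) := by
      rw [tp_unit hj, ← hjm, inner_smul_right]
      ext1
      · rfl
      · simp only; module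
    rw [this, hΦ.map_tp, hall j hj, tp_real, hε]
    simp
  have hneg : (Φ (-1, 0)).2 = 0 := by
    rcases hΦ.map_neg_one with h | h <;> rw [h]
  by_cases hS : ∃ m : E3, ‖m‖ = 1 ∧ ∃ a l : ℝ, |l| ≤ a ∧ (Φ (a, l • m)).2 ≠ 0
  · obtain ⟨m, hm, a, l, hl, hne⟩ := hS
    refine hΦ.not_span (e := (Φ (a, l • m)).2) (fun k hk b p hp => ?_) (fun k hk => ?_) ?_
    · rw [hrot k m hk hm]
      exact (hΦ.map_par hm hl b p).exists_smul hne
    · exact ⟨0, by rw [hall k hk, zero_smul]⟩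
    · exact ⟨0, by rw [hneg, zero_smul]⟩
  · push Not at hS
    refine hΦ.not_span (e := 0) (fun k hk b p hp => ?_) (fun k hk => ?_) ?_
    · exact ⟨0, by rw [hS k hk b p hp, zero_smul]⟩
    · exact ⟨0, by rw [hall k hk, zero_smul]⟩
    · exact ⟨0, by rw [hneg, zero_smul]⟩

end IsNonaxialHom

end SpinFactor

end

/-! ### A functional equation, polar coordinates and nontriviality -/

noncomputable section

namespace SpinFactor

open scoped RealInnerProductSpace

/-- A multiplicative function on `[1, ∞)` with values in `[1, ∞)` that commutes with
`w ↦ 2 w - 1` is constant or the identity. -/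
theorem eq_one_or_id_of_mul {F : ℝ → ℝ} (hmul : ∀ u v, 1 ≤ u → 1 ≤ v → F (u * v) = F u * F v)
    (hdbl : ∀ w, 1 ≤ w → F (2 * w - 1) = 2 * F w - 1) (hge : ∀ u, 1 ≤ u → 1 ≤ F u) :
    (∀ u, 1 ≤ u → F u = 1) ∨ (∀ u, 1 ≤ u → F u = u) := by
  have hmono : ∀ u v, 1 ≤ u → u ≤ v → F u ≤ F v := fun u v hu huv => by
    have h1 : 1 ≤ v / u := (one_le_div (by linarith)).mpr huv
    have h2 : v = u * (v / u) := by field_simp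
    rw [h2, hmul u _ hu h1]
    have := hge _ h1
    have := hge _ hu
    nlinarith
  have h1 : F 1 = 1 := by
    have h2 := hmul 1 1 le_rfl le_rfl
    have h3 := hge 1 le_rfl
    rw [mul_one] at h2
    nlinarith
  -- The chain 2, 3, 5, 9 under w ↦ 2w - 1, together with 9 = 3 · 3, gives a quadratic equation for
  -- `F 2`.
  have e3 : F 3 = 2 * F 2 - 1 := by
    rw [← hdbl 2 (by norm_num)]; norm_num
  have e5 : F 5 = 2 * F 3 - 1 := by
    rw [← hdbl 3 (by norm_num)]; norm_num
  have e9 : F 9 = 2 * F 5 - 1 := by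
    rw [← hdbl 5 (by norm_num)]; norm_num
  have e9' : F 9 = F 3 * F 3 := by
    rw [← hmul 3 3 (by norm_num) (by norm_num)]; norm_num
  have h2 : (F 2 - 1) * (F 2 - 2) = 0 := by
    rw [e9, e5, e3] at e9'
    linear_combination (-1 / 4) * e9'
  rcases mul_eq_zero.mp h2 with h | h
  · left
    intro u hu
    have hp : ∀ n : ℕ, F (2 ^ n) = 1 := fun n => by
      induction n with
      | zero => simpa using h1
      | succ n ih =>
        rw [pow_succ, hmul _ _ (one_le_pow₀ (by norm_num)) (by norm_num), ih]
        linarith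
    obtain ⟨n, hn⟩ := pow_unbounded_of_one_lt u (by norm_num : (1 : ℝ) < 2)
    exact le_antisymm ((hmono _ _ hu hn.le).trans_eq (hp n)) (hge u hu)
  · right
    have hsucc : ∀ v, 1 ≤ v → F (v + 1) = F v + 1 := fun v hv => by
      have h3 := hdbl ((v + 1) / 2) (by linarith)
      have h4 := hmul 2 ((v + 1) / 2) (by norm_num) (by linarith)
      rw [show 2 * ((v + 1) / 2) - 1 = v by ring] at h3
      rw [show 2 * ((v + 1) / 2) = v + 1 by ring] at h4
      rw [h4, h3]
      linear_combination F ((v + 1) / 2) * h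
    have hnat : ∀ n : ℕ, F (n + 1) = n + 1 := fun n => by
      induction n with
      | zero => simpa using h1
      | succ n ih =>
        push_cast
        rw [hsucc _ (by linarith [(Nat.cast_nonneg n : (0 : ℝ) ≤ n)]), ih]
    -- F fixes positive integers and is monotone, so (k + 1) x and its image (k + 1) F(x) lie
    -- between the same consecutive integers.
    have hbd : ∀ x, 1 ≤ x → ∀ k : ℕ, ((k : ℝ) + 1) * |F x - x| ≤ 1 := fun x hx k => by
      have hk : (0 : ℝ) ≤ k := Nat.cast_nonneg k
      have h3 := hmul (k + 1) x (by linarith) hx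
      rw [hnat] at h3
      have hkx : 1 ≤ ((k : ℝ) + 1) * x := by nlinarith
      have hfl : 1 ≤ ⌊((k : ℝ) + 1) * x⌋₊ := Nat.one_le_floor_iff _ |>.mpr hkx
      obtain ⟨m, hm⟩ := Nat.exists_eq_add_of_le' hfl
      have h4 := Nat.floor_le (by linarith : 0 ≤ ((k : ℝ) + 1) * x)
      have h5 := (Nat.lt_floor_add_one (((k : ℝ) + 1) * x)).le
      rw [hm] at h4 h5
      push_cast at h4 h5
      have hm0 : (0 : ℝ) ≤ m := Nat.cast_nonneg m
      have h6 := hmono _ _ (by linarith) h4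
      have h7 := hmono _ _ hkx h5
      have h8 := hnat (m + 1)
      push_cast at h8
      rw [hnat, h3] at h6
      rw [h3, h8] at h7
      rw [← abs_of_nonneg (by linarith : 0 ≤ (k : ℝ) + 1), ← abs_mul, abs_le]
      constructor <;> nlinarith
    intro x hx
    by_contra hne
    have hpos : 0 < |F x - x| := abs_pos.mpr (sub_ne_zero.mpr hne)
    obtain ⟨k, hk⟩ := exists_nat_gt (1 / |F x - x|)
    have := hbd x hx k
    rw [div_lt_iff₀ hpos] at hk
    nlinarith

namespace IsNonaxialHom

variable {Φ : ℝ × E3 → ℝ × E3}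

/-- The action of `Φ` on unit vectors. -/
def axis (Φ : ℝ × E3 → ℝ × E3) (n : E3) : E3 := (Φ (0, n)).2

theorem map_unit_eq (hΦ : IsNonaxialHom Φ) {n : E3} (hn : ‖n‖ = 1) :
    Φ (0, n) = (0, axis Φ n) := by
  ext1
  · exact (hΦ.map_unit hn).1
  · rfl

theorem norm_axis (hΦ : IsNonaxialHom Φ) {n : E3} (hn : ‖n‖ = 1) : ‖axis Φ n‖ = 1 :=
  (hΦ.map_unit hn).2

theorem axis_ne_zero (hΦ : IsNonaxialHom Φ) {n : E3} (hn : ‖n‖ = 1) : axis Φ n ≠ 0 := by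
  intro h
  have := hΦ.norm_axis hn
  rw [h, norm_zero] at this
  exact zero_ne_one this

theorem axis_halfturn (hΦ : IsNonaxialHom Φ) {k n : E3} (hk : ‖k‖ = 1) (hn : ‖n‖ = 1) :
    axis Φ ((2 * ⟪k, n⟫) • k - n) = (2 * ⟪axis Φ k, axis Φ n⟫) • axis Φ k - axis Φ n := by
  have h := hΦ.map_tp (0, k) (0, n)
  rw [tp_unit hk, hΦ.map_unit_eq hk, hΦ.map_unit_eq hn, tp_unit (hΦ.norm_axis hk)] at h
  exact congrArg Prod.snd h

/-- In polar coordinates, the image of a positive element depends on its axis only through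
`axis Φ`. -/
theorem exists_polar (hΦ : IsNonaxialHom Φ) : ∃ p q : ℝ → ℝ → ℝ, ∀ n : E3, ‖n‖ = 1 →
    ∀ a l : ℝ, |l| ≤ a → Φ (a, l • n) = (p a l, q a l • axis Φ n) := by
  obtain ⟨n₀, hn₀, -⟩ := exists_perp 0
  have h : ∀ a l : ℝ, ∃ q : ℝ, |l| ≤ a → (Φ (a, l • n₀)).2 = q • axis Φ n₀ := fun a l => by
    by_cases hl : |l| ≤ a
    -- The unit vector itself commutes with the positive element, which ties the image to `axis Φ
    -- n₀`.
    · have := hΦ.map_par hn₀ hl 0 1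
      rw [one_smul] at this
      obtain ⟨c, hc⟩ := this.symm.exists_smul (hΦ.axis_ne_zero hn₀)
      exact ⟨c, fun _ => hc⟩
    · exact ⟨0, fun h => absurd h hl⟩
  choose q hq using h
  refine ⟨fun a l => (Φ (a, l • n₀)).1, q, fun n hn a l hl => ?_⟩
  obtain ⟨k, hk, hkn⟩ := exists_halfturn hn₀ hn
  have hA : (a, l • n) = tp (0, k) (a, l • n₀) := by
    rw [tp_unit hk, ← hkn, inner_smul_right]
    ext1
    · rfl
    · simp only; module
  have hax := hΦ.axis_halfturn hk hn₀
  rw [hkn] at hax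
  rw [hA, hΦ.map_tp, hΦ.map_unit_eq hk, tp_unit (hΦ.norm_axis hk), hq a l hl, hax,
    inner_smul_right]
  ext1
  · rfl
  · simp only; module

theorem not_axis_span (hΦ : IsNonaxialHom Φ) {e : E3}
    (h : ∀ n : E3, ‖n‖ = 1 → ∃ c : ℝ, axis Φ n = c • e) : False := by
  obtain ⟨p, q, hpq⟩ := hΦ.exists_polar
  refine hΦ.not_span (e := e) (fun n hn a l hl => ?_) h ?_
  · obtain ⟨c, hc⟩ := h n hn
    exact ⟨q a l * c, by rw [hpq n hn a l hl, hc, mul_smul]⟩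
  · rcases hΦ.map_neg_one with h | h <;> exact ⟨0, by rw [h, zero_smul]⟩

/-- For S positive of determinant one, S S⁻² S = 1 and S S⁻¹ S = S, while S⁻¹ = JSJ for a unit
vector J orthogonal to its axis. Hence d = det Φ(S) is nonzero with d³ = d, and d ≥ 0 by positivity.
-/
theorem sdet_map (hΦ : IsNonaxialHom Φ) {n : E3} (hn : ‖n‖ = 1) {c s : ℝ} (hs : |s| ≤ c)
    (hcs : c ^ 2 - s ^ 2 = 1) : sdet (Φ (c, s • n)) = 1 := by
  have hpsd := hΦ.map_psd hn hs
  have h1 : tp (c, s • n) (c ^ 2 + s ^ 2, (-2 * c * s) • n) = (1, 0) := by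
    rw [tp_axis hn]
    ext1
    · simp only
      linear_combination (c ^ 2 - s ^ 2 + 1) * hcs
    · simp only
      rw [show 2 * c * (c ^ 2 + s ^ 2) * s + s ^ 2 * (-2 * c * s) + c ^ 2 * (-2 * c * s) = 0 by ring,
        zero_smul]
  have h2 : tp (c, s • n) (c, (-s) • n) = (c, s • n) := by
    rw [tp_axis hn]
    ext1
    · simp only; linear_combination c * hcs
    · simp only; congr 1; linear_combination s * hcs
  obtain ⟨m, hm, hnm⟩ := exists_perp n
  have h3 : tp (0, m) (c, s • n) = (c, (-s) • n) := by
    rw [tp_unit hm, inner_smul_right, real_inner_comm, hnm]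
    simp
  have d1 := congrArg (fun X => sdet (Φ X)) h1
  have d2 := congrArg (fun X => sdet (Φ X)) h2
  have d3 := congrArg (fun X => sdet (Φ X)) h3
  simp only [hΦ.map_tp _ _, sdet_tp, hΦ.map_one, hΦ.map_unit_eq hm] at d1 d2 d3
  have hJ : sdet (0, axis Φ m) = -1 := by
    simp [sdet, hΦ.norm_axis hm]
  rw [hJ] at d3
  rw [← d3] at d2
  have hnn : 0 ≤ sdet (Φ (c, s • n)) := by
    simp only [sdet]
    nlinarith [norm_nonneg (Φ (c, s • n)).2]
  have he : sdet (1, (0 : E3)) = 1 := by simp [sdet]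
  rw [he] at d1
  generalize sdet (Φ (c, s • n)) = d at *
  have hd : d ≠ 0 := by
    rintro rfl
    simp at d1
  have h4 : d * (d ^ 2 - 1) = 0 := by linear_combination d2
  have h5 := (mul_eq_zero.mp h4).resolve_left hd
  nlinarith

/-- Triviality makes the image of every positive definite element scalar. Some S of determinant one
carries m to an indefinite SmS with direction p, which is also RpR with R positive definite;
applying Φ makes the two images proportional. -/
theorem axis_span_of_trivial (hΦ : IsNonaxialHom Φ)
    (htriv : ∀ n : E3, ‖n‖ = 1 → ∀ c s : ℝ, |s| ≤ c → c ^ 2 - s ^ 2 = 1 → Φ (c, s • n) = (1, 0))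
    {m p : E3} (hm : ‖m‖ = 1) (hp : ‖p‖ = 1) (hmp : 0 < ⟪m, p⟫) :
    ∃ c : ℝ, axis Φ m = c • axis Φ p := by
  have hpos : ∀ n : E3, ‖n‖ = 1 → ∀ a l : ℝ, |l| < a → ∃ c : ℝ, Φ (a, l • n) = (c, 0) := by
    intro n hn a l hl
    obtain ⟨h1, h2⟩ := abs_lt.mp hl
    have hr : 0 < a ^ 2 - l ^ 2 := by nlinarith
    have hr' := Real.sqrt_pos.mpr hr
    have hsq := Real.sq_sqrt hr.le
    set r := √(a ^ 2 - l ^ 2)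
    have hA : (a, l • n) = r • (a / r, (l / r) • n) := by
      ext1
      · simp only [Prod.smul_fst, smul_eq_mul]; field_simp
      · simp only [Prod.smul_snd, smul_smul]; congr 1; field_simp
    refine ⟨(Φ (r, 0)).1, ?_⟩
    rw [hA, hΦ.map_smul hr'.le, htriv n hn]
    · simp
    · rw [abs_div, abs_of_pos hr']; gcongr
    · field_simp; linarith
  -- Halving gives `v = p - κ • m` the inner product κ with m. For S along v with vector length β,
  -- SmS has vector part m + (2β²κ/‖v‖²) v, which equals κ⁻¹p exactly when β² = ‖v‖²/(2κ²).
  set κ := ⟪m, p⟫ / 2 with hκ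
  have hκ0 : 0 < κ := by positivity
  have hκ1 : κ ≤ 1 / 2 := by
    have := real_inner_le_norm m p
    rw [hm, hp] at this
    linarith
  set v := p - κ • m with hv
  have hv0 : v ≠ 0 := by
    intro h
    have h1 : p = κ • m := sub_eq_zero.mp h
    have h2 := congrArg norm h1
    rw [norm_smul, hm, hp, Real.norm_eq_abs, abs_of_pos hκ0] at h2
    linarith
  have hvm : ⟪v, m⟫ = κ := by
    rw [hv, inner_sub_left, inner_smul_left, real_inner_self_eq_norm_sq, hm, real_inner_comm,
      conj_trivial]
    linarith
  have hz : ‖‖v‖⁻¹ • v‖ = 1 := by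
    rw [norm_smul, norm_inv, norm_norm, inv_mul_cancel₀ (norm_ne_zero_iff.mpr hv0)]
  have hvn : 0 < ‖v‖ := norm_pos_iff.mpr hv0
  have hb := Real.sq_sqrt (show 0 ≤ ‖v‖ ^ 2 / (2 * κ ^ 2) by positivity)
  set β := √(‖v‖ ^ 2 / (2 * κ ^ 2))
  have hβ0 : 0 ≤ β := Real.sqrt_nonneg _
  have ha := Real.sq_sqrt (show 0 ≤ 1 + β ^ 2 by positivity)
  set α := √(1 + β ^ 2)
  have hα0 : 0 ≤ α := Real.sqrt_nonneg _
  have hS := htriv _ hz α β (by rw [abs_of_nonneg hβ0]; nlinarith) (by linarith)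
  have hSJ : tp (α, β • (‖v‖⁻¹ • v)) (0, m) = (2 * β * α * κ * ‖v‖⁻¹, κ⁻¹ • p) := by
    have hd := sdet_axis hz α β
    simp only [tp, hd, inner_smul_left, hvm, conj_trivial]
    ext1
    · simp only; ring
    · simp only
      rw [show p = v + κ • m by rw [hv]; module, smul_add, smul_smul, smul_smul, smul_smul,
        inv_mul_cancel₀ hκ0.ne', one_smul, ha]
      congr 2
      · simp only [mul_zero, zero_add]
        calc 2 * (β * (‖v‖⁻¹ * κ)) * β * ‖v‖⁻¹ = 2 * β ^ 2 * κ * (‖v‖⁻¹) ^ 2 := by ring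
          _ = κ⁻¹ := by rw [hb]; field_simp
      · rw [show 1 + β ^ 2 - β ^ 2 = 1 by ring, one_smul]
  have hdet := congrArg sdet hSJ
  rw [sdet_tp, sdet_axis hz, show α ^ 2 - β ^ 2 = 1 by linarith] at hdet
  set w := 2 * β * α * κ * ‖v‖⁻¹
  have hJ : sdet (0, m) = -1 := by simp [sdet, hm]
  rw [hJ] at hdet
  obtain ⟨n, hn, hnA, α', β', hαβ, K, hK, hA⟩ := exists_psd_conj (w, κ⁻¹ • p)
  have hnp : n = p := by
    simp only [norm_smul, hp, norm_inv, Real.norm_eq_abs, abs_of_pos hκ0, mul_one] at hnA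
    exact (smul_right_injective E3 (inv_ne_zero hκ0.ne') hnA).symm
  subst hnp
  have hw : |w| < ‖κ⁻¹ • n‖ := by
    refine abs_lt_of_sq_lt_sq ?_ (norm_nonneg _)
    simp only [sdet] at hdet
    linarith
  obtain ⟨hw1, hw2⟩ := abs_lt.mp hw
  rcases hK with ⟨h, -⟩ | ⟨h, -⟩ | ⟨-, rfl⟩
  · simp only at h; linarith
  · simp only at h; linarith
  -- Equality would give determinant 0, but SmS has determinant -1.
  have hlt : |β'| < α' := by
    refine lt_of_le_of_ne hαβ fun h => ?_
    have hdet' := congrArg sdet hA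
    have hs0 : sdet (α', β' • n) = 0 := by rw [sdet_axis hn, ← h, sq_abs, sub_self]
    rw [sdet_tp, hs0] at hdet'
    linarith
  obtain ⟨c, hc⟩ := hpos n hn α' β' hlt
  have e1 := congrArg Φ (hSJ.trans hA)
  rw [hΦ.map_tp, hΦ.map_tp, hS, hc, hΦ.map_unit_eq hm, hΦ.map_unit_eq hn, tp_real, tp_real] at e1
  refine ⟨c ^ 2, ?_⟩
  have := congrArg Prod.snd e1
  simpa using this

/-- A vector at angle at most π/2 to m is linked to it through their bisector, which makes an acute
angle with both. Otherwise its opposite is, and the half-turn about -n fixes n. -/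
theorem not_trivial (hΦ : IsNonaxialHom Φ)
    (htriv : ∀ n : E3, ‖n‖ = 1 → ∀ c s : ℝ, |s| ≤ c → c ^ 2 - s ^ 2 = 1 →
      Φ (c, s • n) = (1, 0)) : False := by
  obtain ⟨m, hm, -⟩ := exists_perp 0
  have key : ∀ n : E3, ‖n‖ = 1 → 0 ≤ ⟪m, n⟫ → ∃ c : ℝ, axis Φ n = c • axis Φ m := by
    intro n hn hmn
    have h2 : 0 < ‖m + n‖ ^ 2 := by
      rw [norm_add_sq_real, hm, hn]; linarith
    have h0 : ‖m + n‖ ≠ 0 := by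
      intro h; rw [h] at h2; norm_num at h2
    have hpos : 0 < ‖m + n‖ := lt_of_le_of_ne (norm_nonneg _) h0.symm
    have hk : ‖‖m + n‖⁻¹ • (m + n)‖ = 1 := by
      rw [norm_smul, norm_inv, norm_norm, inv_mul_cancel₀ h0]
    obtain ⟨c, hc⟩ := hΦ.axis_span_of_trivial htriv hn hk (by
      rw [inner_smul_right, inner_add_right, real_inner_self_eq_norm_sq, hn, real_inner_comm]
      positivity)
    obtain ⟨d, hd⟩ := hΦ.axis_span_of_trivial htriv hk hm (by
      rw [inner_smul_left, inner_add_left, real_inner_self_eq_norm_sq, hm, real_inner_comm,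
        conj_trivial]
      positivity)
    exact ⟨c * d, by rw [hc, hd, mul_smul]⟩
  refine hΦ.not_axis_span (e := axis Φ m) fun n hn => ?_
  rcases le_total 0 ⟪m, n⟫ with h | h
  · exact key n hn h
  · have hn' : ‖-n‖ = 1 := by rw [norm_neg, hn]
    obtain ⟨c, hc⟩ := key (-n) hn' (by rw [inner_neg_right]; linarith)
    have h1 := hΦ.axis_halfturn hn' hn
    rw [inner_neg_left, real_inner_self_eq_norm_sq, hn,
      show (2 * -(1 : ℝ) ^ 2) • -n - n = n by module] at h1
    refine ⟨⟪axis Φ (-n), axis Φ n⟫ * c, ?_⟩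
    rw [mul_smul, ← hc]
    have h2 : (2 : ℝ) • axis Φ n = (2 : ℝ) • (⟪axis Φ (-n), axis Φ n⟫ • axis Φ (-n)) := by
      rw [smul_smul, two_smul]
      exact eq_sub_iff_add_eq.mp h1
    exact smul_right_injective E3 (two_ne_zero (α := ℝ)) h2

end IsNonaxialHom

end SpinFactor

end

/-! ### The hyperbolic law of cosines and the induced isometry -/

noncomputable section

namespace SpinFactor

open scoped RealInnerProductSpace

theorem smul_of_inner_preserving {H : E3 → E3} (hH : ∀ u v, ⟪H u, H v⟫ = ⟪u, v⟫) (l : ℝ) (u : E3) :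
    H (l • u) = l • H u := by
  rw [← sub_eq_zero, ← inner_self_eq_zero (𝕜 := ℝ)]
  simp only [inner_sub_left, inner_sub_right, inner_smul_left, inner_smul_right, hH, conj_trivial]
  ring

theorem norm_of_inner_preserving {H : E3 → E3} (hH : ∀ u v, ⟪H u, H v⟫ = ⟪u, v⟫) (u : E3) :
    ‖H u‖ = ‖u‖ := by
  rw [← sq_eq_sq₀ (norm_nonneg _) (norm_nonneg _), ← real_inner_self_eq_norm_sq, hH,
    real_inner_self_eq_norm_sq]

theorem tp_smul_smul (k τ : ℝ) (X Y : ℝ × E3) : tp (k • X) (τ • Y) = (k ^ 2 * τ) • tp X Y := by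
  obtain ⟨x, ξ⟩ := X
  obtain ⟨y, υ⟩ := Y
  simp only [tp, sdet, Prod.smul_mk, inner_smul_left, inner_smul_right, conj_trivial, norm_smul,
    mul_pow, Real.norm_eq_abs, sq_abs, smul_eq_mul]
  ext1
  · simp only; ring
  · simp only; module

namespace IsNonaxialHom

variable {Φ : ℝ × E3 → ℝ × E3}

/-- A nonaxial homomorphism acts on positive elements of determinant one in the polar form given by
`F` and `q`, and satisfies the hyperbolic law of cosines. -/
theorem exists_cosine_law (hΦ : IsNonaxialHom Φ) : ∃ F q : ℝ → ℝ,
    (∀ n : E3, ‖n‖ = 1 → ∀ c, 1 ≤ c → Φ (c, √(c ^ 2 - 1) • n) = (F c, q c • axis Φ n)) ∧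
    (∀ c, 1 ≤ c → q c ^ 2 = F c ^ 2 - 1) ∧ (∀ c, 1 ≤ c → 1 ≤ F c) ∧
    ∀ n m : E3, ‖n‖ = 1 → ‖m‖ = 1 → ∀ a b, 1 ≤ a → 1 ≤ b →
      1 ≤ 2 * (a * b + √(a ^ 2 - 1) * √(b ^ 2 - 1) * ⟪n, m⟫) * a - b ∧
      F (2 * (a * b + √(a ^ 2 - 1) * √(b ^ 2 - 1) * ⟪n, m⟫) * a - b) =
        2 * (F a * F b + q a * q b * ⟪axis Φ n, axis Φ m⟫) * F a - F b := by
  obtain ⟨p, q, hpq⟩ := hΦ.exists_polar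
  have hsq : ∀ c : ℝ, 1 ≤ c → √(c ^ 2 - 1) ^ 2 = c ^ 2 - 1 := fun c hc =>
    Real.sq_sqrt (by nlinarith)
  have hle : ∀ c : ℝ, 1 ≤ c → |√(c ^ 2 - 1)| ≤ c := fun c hc => by
    rw [abs_of_nonneg (Real.sqrt_nonneg _), Real.sqrt_le_left (by linarith)]
    linarith
  have hform : ∀ n : E3, ‖n‖ = 1 → ∀ c, 1 ≤ c → Φ (c, √(c ^ 2 - 1) • n) =
      (p c √(c ^ 2 - 1), q c √(c ^ 2 - 1) • axis Φ n) := fun n hn c hc =>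
    hpq n hn c _ (hle c hc)
  have hdet : ∀ c, 1 ≤ c → p c √(c ^ 2 - 1) ^ 2 - q c √(c ^ 2 - 1) ^ 2 = 1 := fun c hc => by
    obtain ⟨n, hn, -⟩ := exists_perp 0
    have := hΦ.sdet_map hn (hle c hc) (by rw [hsq c hc]; ring)
    rwa [hform n hn c hc, sdet_axis (hΦ.norm_axis hn)] at this
  refine ⟨fun c => p c √(c ^ 2 - 1), fun c => q c √(c ^ 2 - 1), hform, fun c hc => ?_,
    fun c hc => ?_, fun n m hn hm a b ha hb => ?_⟩
  · linarith [hdet c hc]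
  · obtain ⟨n, hn, -⟩ := exists_perp 0
    have h1 := hΦ.map_psd hn (hle c hc)
    rw [hform n hn c hc] at h1
    have h2 : 0 ≤ p c √(c ^ 2 - 1) := (norm_nonneg _).trans h1
    have h3 := hdet c hc
    nlinarith [sq_nonneg (q c √(c ^ 2 - 1))]
  · have hsa := hsq a ha
    have hsb := hsq b hb
    have hfa := hform n hn a ha
    have hfb := hform m hm b hb
    have hsa0 := Real.sqrt_nonneg (a ^ 2 - 1)
    have hsb0 := Real.sqrt_nonneg (b ^ 2 - 1)
    have hdA := sdet_axis hn a √(a ^ 2 - 1)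
    have hdB := sdet_axis hm b √(b ^ 2 - 1)
    rw [hsa, sub_sub_cancel] at hdA
    rw [hsb, sub_sub_cancel] at hdB
    have hw : (tp (a, √(a ^ 2 - 1) • n) (b, √(b ^ 2 - 1) • m)).1 =
        2 * (a * b + √(a ^ 2 - 1) * √(b ^ 2 - 1) * ⟪n, m⟫) * a - b := by
      simp only [tp, hdA, inner_smul_left, inner_smul_right, conj_trivial]
      ring
    have hd := sdet_tp (a, √(a ^ 2 - 1) • n) (b, √(b ^ 2 - 1) • m)
    rw [hdA, hdB] at hd
    have hmap := hΦ.map_tp (a, √(a ^ 2 - 1) • n) (b, √(b ^ 2 - 1) • m)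
    rw [← hw]
    generalize tp (a, √(a ^ 2 - 1) • n) (b, √(b ^ 2 - 1) • m) = X at *
    have hX : ‖X.2‖ ^ 2 = X.1 ^ 2 - 1 := by
      simp only [sdet] at hd; linarith
    -- The worst case is ⟪n, m⟫ = -1, where the claim follows from (2a² - 1)²b² - 4a²(a² - 1)(b² -
    -- 1) = b² + 4a²(a² - 1).
    have hpos : 0 ≤ X.1 := by
      rw [hw]
      have ht := abs_le.mp (abs_real_inner_le_norm n m)
      rw [hn, hm] at ht
      have hab : 2 * a * (√(a ^ 2 - 1) * √(b ^ 2 - 1)) ≤ (2 * a ^ 2 - 1) * b := by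
        refine abs_le_of_sq_le_sq' ?_ (by nlinarith) |>.2
        have e : (2 * a * (√(a ^ 2 - 1) * √(b ^ 2 - 1))) ^ 2 =
            4 * a ^ 2 * ((a ^ 2 - 1) * (b ^ 2 - 1)) := by
          rw [mul_pow, mul_pow, mul_pow, hsa, hsb]; ring
        rw [e]
        nlinarith [mul_nonneg (sq_nonneg a) (by nlinarith : 0 ≤ a ^ 2 - 1)]
      have h0 : 0 ≤ 2 * a * (√(a ^ 2 - 1) * √(b ^ 2 - 1)) := by positivity
      nlinarith
    have hX1 : 1 ≤ X.1 := by nlinarith [sq_nonneg ‖X.2‖]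
    obtain ⟨k, hk, hXk⟩ := exists_axis X.2
    have hXs : ‖X.2‖ = √(X.1 ^ 2 - 1) := by
      rw [← hX, Real.sqrt_sq (norm_nonneg _)]
    have hXe : X = (X.1, √(X.1 ^ 2 - 1) • k) := by
      ext1
      · rfl
      · rw [← hXs]; exact hXk
    have h1 := hform k hk X.1 hX1
    rw [← hXe, hmap, hfa, hfb] at h1
    have h2 := congrArg Prod.fst h1
    simp only [tp, sdet_axis (hΦ.norm_axis hn), hdet a ha, inner_smul_left, inner_smul_right,
      conj_trivial] at h2
    refine ⟨hX1, ?_⟩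
    beta_reduce
    rw [← h2]
    ring

/-- The law of cosines is specialised. Opposite directions show that `axis Φ` is odd, whence
half-turns show that it keeps orthogonality; b = 1 gives F(2c² - 1) = 2F(c)² - 1; orthogonal
directions then make F multiplicative. Once F = id, the law compares inner products directly. The
sign σ is that of q, and is absorbed into H. -/
theorem exists_isometry (hΦ : IsNonaxialHom Φ) : ∃ σ : ℝ, (σ = 1 ∨ σ = -1) ∧ ∃ H : E3 → E3,
    (∀ u v, ⟪H u, H v⟫ = ⟪u, v⟫) ∧ (∀ n : E3, ‖n‖ = 1 → Φ (0, n) = σ • (0, H n)) ∧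
    ∀ n : E3, ‖n‖ = 1 → ∀ c, 1 ≤ c → Φ (c, √(c ^ 2 - 1) • n) = (c, √(c ^ 2 - 1) • H n) := by
  obtain ⟨F, q, hform, hq, hF, hlaw⟩ := hΦ.exists_cosine_law
  have hF1 : F 1 = 1 := by
    obtain ⟨n, hn, -⟩ := exists_perp 0
    have := congrArg Prod.fst (hform n hn 1 le_rfl)
    simp [hΦ.map_one] at this
    exact this.symm
  have hq1 : q 1 = 0 := by
    have := hq 1 le_rfl
    rw [hF1] at this
    simpa using this
  have hsq : ∀ c : ℝ, 1 ≤ c → √(c ^ 2 - 1) ^ 2 = c ^ 2 - 1 := fun c hc =>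
    Real.sq_sqrt (by nlinarith)
  have hnontriv : ∃ c, 1 ≤ c ∧ F c ≠ 1 := by
    by_contra hcon
    push Not at hcon
    refine hΦ.not_trivial fun n hn c s hs hcs => ?_
    have hc0 : 0 ≤ c := (abs_nonneg s).trans hs
    have hc : 1 ≤ c := by nlinarith [sq_nonneg s]
    have hq0 : q c = 0 := by
      have := hq c hc
      rw [hcon c hc] at this
      simpa using this
    obtain ⟨k, hk, hks⟩ : ∃ k : E3, ‖k‖ = 1 ∧ s • n = √(c ^ 2 - 1) • k := by
      have hss : √(c ^ 2 - 1) = |s| := by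
        rw [← Real.sqrt_sq_eq_abs]; congr 1; linarith
      rcases abs_choice s with h | h
      · exact ⟨n, hn, by rw [hss, h]⟩
      · exact ⟨-n, by rw [norm_neg, hn], by rw [hss, h]; module⟩
    rw [hks, hform k hk c hc, hcon c hc, hq0, zero_smul]
  have hodd : ∀ n : E3, ‖n‖ = 1 → axis Φ (-n) = -axis Φ n := by
    intro n hn
    obtain ⟨c, hc, hFc⟩ := hnontriv
    have hn' : ‖-n‖ = 1 := by rw [norm_neg, hn]
    have hqc : q c ≠ 0 := by
      intro h
      have h1 := hq c hc
      have h2 := hF c hc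
      rw [h] at h1
      exact hFc (by nlinarith)
    have h1 := (hlaw n (-n) hn hn' c c hc hc).2
    rw [inner_neg_right, real_inner_self_eq_norm_sq, hn] at h1
    have h2 : 2 * (c * c + √(c ^ 2 - 1) * √(c ^ 2 - 1) * -1 ^ 2) * c - c = c := by
      have := hsq c hc
      linear_combination (-2 * c) * this
    rw [h2] at h1
    have hFpos := hF c hc
    have h3 : 2 * F c * (q c * q c) * (1 + ⟪axis Φ n, axis Φ (-n)⟫) = 0 := by
      linear_combination -h1 + 2 * F c * hq c hc
    have h4 : (1 + ⟪axis Φ n, axis Φ (-n)⟫) = 0 := by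
      refine (mul_eq_zero.mp h3).resolve_left ?_
      have : F c ≠ 0 := by linarith
      positivity
    rw [← add_eq_zero_iff_eq_neg, ← norm_eq_zero, ← sq_eq_zero_iff, norm_add_sq_real,
      hΦ.norm_axis hn, hΦ.norm_axis hn', real_inner_comm]
    linarith
  have hperp : ∀ n m : E3, ‖n‖ = 1 → ‖m‖ = 1 → ⟪n, m⟫ = 0 → ⟪axis Φ n, axis Φ m⟫ = 0 := by
    intro n m hn hm hnm
    have h1 := hΦ.axis_halfturn hn hm
    rw [hnm, mul_zero, zero_smul, zero_sub, hodd m hm] at h1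
    have h2 : (2 * ⟪axis Φ n, axis Φ m⟫) • axis Φ n = 0 := by
      rw [← sub_eq_neg_self.mp h1.symm]
    have h3 := (smul_eq_zero.mp h2).resolve_right (hΦ.axis_ne_zero hn)
    linarith
  obtain ⟨e₁, he₁, -⟩ := exists_perp 0
  obtain ⟨e₂, he₂, he₁₂⟩ := exists_perp e₁
  have hcheb : ∀ c, 1 ≤ c → F (2 * c ^ 2 - 1) = 2 * F c ^ 2 - 1 := by
    intro c hc
    have := (hlaw e₁ e₁ he₁ he₁ c 1 hc le_rfl).2
    rw [hF1, hq1] at this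
    simp only [one_pow, sub_self, Real.sqrt_zero] at this
    rw [show 2 * c ^ 2 - 1 = 2 * (c * 1 + √(c ^ 2 - 1) * 0 * ⟪e₁, e₁⟫) * c - 1 by ring, this]
    ring
  have hmul : ∀ u v, 1 ≤ u → 1 ≤ v → F (u * v) = F u * F v := by
    intro u v hu hv
    have hs := Real.sq_sqrt (show 0 ≤ (u + 1) / 2 by linarith)
    have hc : 1 ≤ √((u + 1) / 2) := Real.one_le_sqrt.mpr (by linarith)
    have h1 := (hlaw e₁ e₂ he₁ he₂ _ v hc hv).2
    have h2 := hcheb _ hc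
    rw [hperp _ _ he₁ he₂ he₁₂, he₁₂] at h1
    set c := √((u + 1) / 2)
    rw [show 2 * c ^ 2 - 1 = u by rw [hs]; ring] at h2
    have h3 : 2 * (c * v + √(c ^ 2 - 1) * √(v ^ 2 - 1) * 0) * c - v = u * v := by
      linear_combination 2 * v * hs
    rw [h3] at h1
    rw [h1, h2]
    ring
  have hid : ∀ u, 1 ≤ u → F u = u := by
    refine (eq_one_or_id_of_mul hmul (fun w hw => ?_) hF).resolve_left ?_
    · have hs := Real.sq_sqrt (show 0 ≤ w by linarith)
      have hc : 1 ≤ √w := Real.one_le_sqrt.mpr hw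
      have h1 := hcheb _ hc
      have h2 := hmul _ _ hc hc
      rw [← pow_two, hs] at h2
      rw [hs] at h1
      rw [h1, h2]
      ring
    · intro h
      obtain ⟨c, hc, hne⟩ := hnontriv
      exact hne (h c hc)
  have hinner : ∀ n m : E3, ‖n‖ = 1 → ‖m‖ = 1 → ∀ a b, 1 ≤ a → 1 ≤ b →
      √(a ^ 2 - 1) * √(b ^ 2 - 1) * ⟪n, m⟫ = q a * q b * ⟪axis Φ n, axis Φ m⟫ := by
    intro n m hn hm a b ha hb
    obtain ⟨h0, h1⟩ := hlaw n m hn hm a b ha hb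
    rw [hid a ha, hid b hb, hid _ h0] at h1
    have h2 : a * (√(a ^ 2 - 1) * √(b ^ 2 - 1) * ⟪n, m⟫ - q a * q b * ⟪axis Φ n, axis Φ m⟫) =
        0 := by linear_combination (1 / 2) * h1
    exact sub_eq_zero.mp ((mul_eq_zero.mp h2).resolve_left (by linarith))
  have hs2 : √((2 : ℝ) ^ 2 - 1) ^ 2 = 3 := by rw [hsq 2 (by norm_num)]; norm_num
  have hq2 : q 2 ^ 2 = 3 := by rw [hq 2 (by norm_num), hid 2 (by norm_num)]; norm_num
  have hs2pos : 0 < √((2 : ℝ) ^ 2 - 1) := Real.sqrt_pos.mpr (by norm_num)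
  have hax : ∀ n m : E3, ‖n‖ = 1 → ‖m‖ = 1 → ⟪axis Φ n, axis Φ m⟫ = ⟪n, m⟫ := by
    intro n m hn hm
    have := hinner n m hn hm 2 2 (by norm_num) (by norm_num)
    linear_combination (-1 / 3) * this + (1 / 3) * ⟪n, m⟫ * hs2 -
      (1 / 3) * ⟪axis Φ n, axis Φ m⟫ * hq2
  set r := √((2 : ℝ) ^ 2 - 1)
  -- At c = 2 both q(c)² and c² - 1 equal 3, so this is q(2)/√3.
  set σ := q 2 * r / 3 with hσ
  have hσ2 : σ ^ 2 = 1 := by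
    rw [hσ]; linear_combination (r ^ 2 / 9) * hq2 + (1 / 3) * hs2
  have hqσ : ∀ c, 1 ≤ c → q c = σ * √(c ^ 2 - 1) := by
    intro c hc
    have := hinner e₁ e₁ he₁ he₁ c 2 hc (by norm_num)
    rw [hax _ _ he₁ he₁, real_inner_self_eq_norm_sq, he₁] at this
    rw [hσ]
    linear_combination (-q 2 / 3) * this - (q c / 3) * hq2
  -- H extends σ times the action on directions homogeneously from the unit sphere.
  refine ⟨σ, by simpa using sq_eq_sq_iff_eq_or_eq_neg.mp (hσ2.trans (one_pow 2).symm), fun u => (σ * ‖u‖) • axis Φ (‖u‖⁻¹ • u), fun u v => ?_,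
    fun n hn => ?_, fun n hn c hc => ?_⟩
  · by_cases hu : u = 0
    · simp [hu]
    by_cases hv : v = 0
    · simp [hv]
    have hu' := norm_ne_zero_iff.mpr hu
    have hv' := norm_ne_zero_iff.mpr hv
    have h1 : ∀ w : E3, ‖w‖ ≠ 0 → ‖‖w‖⁻¹ • w‖ = 1 := fun w hw => by
      rw [norm_smul, norm_inv, norm_norm, inv_mul_cancel₀ hw]
    simp only [inner_smul_left, inner_smul_right, conj_trivial, hax _ _ (h1 u hu') (h1 v hv')]
    field_simp
    rw [hσ2, one_mul]
  · simp only [hn, mul_one, inv_one, one_smul]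
    rw [hΦ.map_unit_eq hn, Prod.smul_mk, smul_zero, smul_smul, ← pow_two, hσ2, one_smul]
  · simp only [hn, mul_one, inv_one, one_smul]
    rw [hform n hn c hc, hid c hc, hqσ c hc, smul_smul, mul_comm]

end IsNonaxialHom

end SpinFactor

end

/-! ### Classification on the spin factor -/

noncomputable section

namespace SpinFactor

open scoped RealInnerProductSpace

/-- The action of `H` on the vector part. -/
def vecMap (H : E3 → E3) (A : ℝ × E3) : ℝ × E3 := (A.1, H A.2)

namespace IsNonaxialHom

variable {Φ : ℝ × E3 → ℝ × E3}

theorem real_fst_pos (hΦ : IsNonaxialHom Φ) {a : ℝ} (ha : 0 < a) : 0 < (Φ (a, 0)).1 := by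
  refine lt_of_le_of_ne (hΦ.real_fst_nonneg ha.le) fun h => ?_
  have := hΦ.real_fst_mul (b := a⁻¹) ha.le
  rw [mul_inv_cancel₀ ha.ne', hΦ.map_one, ← h, zero_mul] at this
  exact one_ne_zero this

/-- The scalar by which `Φ` differs from an isometry on elements of determinant `t`. -/
def scale (Φ : ℝ × E3 → ℝ × E3) (t : ℝ) : ℝ := (Φ (√t, 0)).1 / √t

theorem scale_mul (hΦ : IsNonaxialHom Φ) {s t : ℝ} (hs : 0 ≤ s) :
    scale Φ (s * t) = scale Φ s * scale Φ t := by
  rw [scale, Real.sqrt_mul hs, hΦ.real_fst_mul (Real.sqrt_nonneg s), mul_div_mul_comm, scale, scale]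

theorem scale_pos (hΦ : IsNonaxialHom Φ) {t : ℝ} (ht : 0 < t) : 0 < scale Φ t :=
  div_pos (hΦ.real_fst_pos (Real.sqrt_pos.mpr ht)) (Real.sqrt_pos.mpr ht)

/-- A positive definite element is √det times one of determinant one; a negative l is handled by
reversing n. -/
theorem map_posdef (hΦ : IsNonaxialHom Φ) {H : E3 → E3} (hH : ∀ u v, ⟪H u, H v⟫ = ⟪u, v⟫)
    (hpos : ∀ n : E3, ‖n‖ = 1 → ∀ c, 1 ≤ c →
      Φ (c, √(c ^ 2 - 1) • n) = (c, √(c ^ 2 - 1) • H n))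
    {n : E3} (hn : ‖n‖ = 1) {a l : ℝ} (hl : |l| < a) :
    Φ (a, l • n) = scale Φ (a ^ 2 - l ^ 2) • (a, l • H n) := by
  have key : ∀ n : E3, ‖n‖ = 1 → ∀ l : ℝ, 0 ≤ l → l < a →
      Φ (a, l • n) = scale Φ (a ^ 2 - l ^ 2) • (a, l • H n) := by
    intro n hn l hl0 hl
    have hr : 0 < a ^ 2 - l ^ 2 := by nlinarith
    have hr' := Real.sqrt_pos.mpr hr
    have hsq := Real.sq_sqrt hr.le
    rw [scale]
    set r := √(a ^ 2 - l ^ 2)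
    have hc : 1 ≤ a / r := by
      rw [one_le_div hr']
      exact abs_le_of_sq_le_sq' (by nlinarith) (by linarith) |>.2
    have hs : √((a / r) ^ 2 - 1) = l / r := by
      rw [show (a / r) ^ 2 - 1 = (l / r) ^ 2 by field_simp; linarith,
        Real.sqrt_sq (by positivity)]
    have hA : ∀ u : E3, (a, l • u) = r • (a / r, (l / r) • u) := fun u => by
      ext1
      · simp only [Prod.smul_fst, smul_eq_mul]; field_simp
      · simp only [Prod.smul_snd, smul_smul]; congr 1; field_simp
    have h := hpos n hn _ hc
    rw [hs] at h
    rw [hA, hΦ.map_smul hr'.le, h, hA, smul_smul, div_mul_cancel₀ _ hr'.ne']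
  obtain ⟨h1, h2⟩ := abs_lt.mp hl
  rcases le_total 0 l with h | h
  · exact key n hn l h h2
  · have := key (-n) (by rw [norm_neg, hn]) (-l) (by linarith) (by linarith)
    have hneg : H (-n) = -H n := by
      have := smul_of_inner_preserving hH (-1) n
      simpa using this
    rw [hneg] at this
    simpa using this

end IsNonaxialHom

/-- The conclusion of the classification for maps killing the singular elements. -/
structure IsSingularVanishing (Φ : ℝ × E3 → ℝ × E3) (H : E3 → E3) (f : ℝ → ℝ) (σ ν : ℝ) :
    Prop where
  pos : ∀ t, 0 < t → 0 < f t
  mul : ∀ s t, 0 < s → 0 < t → f (s * t) = f s * f t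
  singular : ∀ A, sdet A = 0 → Φ A = 0
  posdef : ∀ A : ℝ × E3, ‖A.2‖ < A.1 → Φ A = f |sdet A| • vecMap H A
  indef : ∀ A : ℝ × E3, |A.1| < ‖A.2‖ → Φ A = (σ * f |sdet A|) • vecMap H A
  negdef : ∀ A : ℝ × E3, A.1 < -‖A.2‖ → Φ A = (ν * f |sdet A|) • vecMap H A

/-- On A = SKS the values at S and K decide. The alternative is whether the idempotent image of a
rank-one projection E vanishes. If not, dilations along the axis of E and the identity EE'E = E/2
for orthogonal axes fix the image of E and make Φ the identity on nonnegative scalars. -/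
theorem IsNonaxialHom.classification {Φ : ℝ × E3 → ℝ × E3} (hΦ : IsNonaxialHom Φ) :
    ∃ H : E3 → E3, (∀ u v, ⟪H u, H v⟫ = ⟪u, v⟫) ∧
      ((∀ A, Φ A = vecMap H A) ∨ ∃ f : ℝ → ℝ, ∃ σ ν : ℝ, (σ = 1 ∨ σ = -1) ∧ (ν = 1 ∨ ν = -1) ∧
        IsSingularVanishing Φ H f σ ν) := by
  obtain ⟨σ, hσ, H, hH, hJ, hpos⟩ := hΦ.exists_isometry
  have hHs := smul_of_inner_preserving hH
  have hHn := norm_of_inner_preserving hH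
  have hpd := fun {n : E3} (hn : ‖n‖ = 1) {a l : ℝ} => hΦ.map_posdef hH hpos hn (a := a) (l := l)
  have hneg : ∀ n, H (-n) = -H n := fun n => by simpa using hHs (-1) n
  obtain ⟨ν, hν, hN⟩ : ∃ ν : ℝ, (ν = 1 ∨ ν = -1) ∧ Φ (-1, 0) = ν • (-1, 0) := by
    rcases hΦ.map_neg_one with h | h
    · exact ⟨-1, Or.inr rfl, by rw [h]; simp⟩
    · exact ⟨1, Or.inl rfl, by rw [h]; simp⟩
  have hvm : ∀ {n : E3}, ‖n‖ = 1 → ∀ α β : ℝ, ∀ K : ℝ × E3, (∃ k m : ℝ, K = (k, m • n)) →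
      vecMap H (tp (α, β • n) K) = tp (α, β • H n) (vecMap H K) := by
    rintro n hn α β K ⟨k, m, rfl⟩
    simp only [vecMap, hHs]
    rw [tp_axis hn, tp_axis (by rw [hHn, hn]), hHs]
  have hH0 : H 0 = 0 := by simpa using hHs 0 0
  have hconj : ∀ {n : E3}, ‖n‖ = 1 → ∀ α β k τ : ℝ, ∀ K : ℝ × E3, (∃ k m : ℝ, K = (k, m • n)) →
      Φ (α, β • n) = k • (α, β • H n) → Φ K = τ • vecMap H K →
      Φ (tp (α, β • n) K) = (k ^ 2 * τ) • vecMap H (tp (α, β • n) K) := by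
    intro n hn α β k τ K hK h1 h2
    rw [hΦ.map_tp, h1, h2, tp_smul_smul, hvm hn α β K hK]
  have hKform : ∀ {n : E3} {K : ℝ × E3}, (K = (1, 0) ∨ K = (-1, 0) ∨ K = (0, n)) →
      ∃ k m : ℝ, K = (k, m • n) := by
    rintro n K (rfl | rfl | rfl)
    · exact ⟨1, 0, by simp⟩
    · exact ⟨-1, 0, by simp⟩
    · exact ⟨0, 1, by simp⟩
  have hJ' : ∀ n : E3, ‖n‖ = 1 → Φ (0, n) = σ • vecMap H (0, n) := hJ
  have hN' : Φ (-1, 0) = ν • vecMap H (-1, 0) := by rw [hN, vecMap, hH0]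
  have h1' : Φ (1, 0) = (1 : ℝ) • vecMap H (1, 0) := by
    rw [hΦ.map_one, vecMap, hH0, one_smul]
  have hinv : ∀ (A : ℝ × E3) {n : E3}, ‖n‖ = 1 → ∀ (α β τ : ℝ) (K : ℝ × E3), |β| ≤ α →
      (∃ k m : ℝ, K = (k, m • n)) → |sdet K| = 1 → sdet A ≠ 0 → Φ K = τ • vecMap H K →
      A = tp (α, β • n) K → Φ A = (τ * scale Φ |sdet A|) • vecMap H A := by
    intro A n hn α β τ K hαβ hK hdK hdA hτ hA
    have hd := congrArg sdet hA
    rw [sdet_tp, sdet_axis hn] at hd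
    have hlt : |β| < α := by
      refine lt_of_le_of_ne hαβ fun h => hdA ?_
      rw [hd, ← h, sq_abs]; ring
    have hp : 0 < α ^ 2 - β ^ 2 := by
      have h0 := abs_nonneg β
      have := sq_abs β
      nlinarith
    -- Here |det A| = (det S)², so the two scale factors contributed by S combine.
    have hs : scale Φ |sdet A| = scale Φ (α ^ 2 - β ^ 2) ^ 2 := by
      rw [hd, abs_mul, hdK, mul_one, abs_of_pos (by positivity), sq (α ^ 2 - β ^ 2),
        hΦ.scale_mul hp.le, sq (scale Φ _)]
    rw [hs, hA, hconj hn α β _ τ K hK (hpd hn hlt) hτ, ← hA, mul_comm]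
  have hd1 : |sdet ((1 : ℝ), (0 : E3))| = 1 := by simp [sdet]
  have hdn1 : |sdet (-(1 : ℝ), (0 : E3))| = 1 := by simp [sdet]
  have hdJ : ∀ n : E3, ‖n‖ = 1 → |sdet ((0 : ℝ), n)| = 1 := fun n hn => by simp [sdet, hn]
  refine ⟨H, hH, ?_⟩
  obtain ⟨p, q, hpq⟩ := hΦ.exists_polar
  -- the common value of `Φ` on rank-one projections
  obtain ⟨x, y, hE⟩ : ∃ x y : ℝ, ∀ n : E3, ‖n‖ = 1 →
      Φ (1 / 2, (1 / 2 : ℝ) • n) = (x, y • H n) := by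
    refine ⟨p (1 / 2) (1 / 2), q (1 / 2) (1 / 2) * σ, fun n hn => ?_⟩
    rw [hpq n hn _ _ (by norm_num)]
    have h := congrArg Prod.snd (hJ n hn)
    have h' : IsNonaxialHom.axis Φ n = σ • H n := h
    rw [h', mul_smul]
  obtain ⟨e, he, -⟩ := exists_perp 0
  have hHe : ‖H e‖ = 1 := by rw [hHn, he]
  have hHe0 : H e ≠ 0 := by
    intro h; rw [h, norm_zero] at hHe; exact zero_ne_one hHe
  have hcoef : ∀ {a b : ℝ}, a • H e = b • H e → a = b := fun h =>
    smul_left_injective ℝ hHe0 h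
  have hidem : x ^ 2 + y ^ 2 = x ∧ 2 * x * y = y := by
    have hEE : tp (1 / 2, (1 / 2 : ℝ) • e) (1, (0 : ℝ) • e) = (1 / 2, (1 / 2 : ℝ) • e) := by
      rw [tp_axis he]
      ext1
      · norm_num
      · simp only; congr 1; norm_num
    have h := congrArg Φ hEE
    rw [hΦ.map_tp, hE e he, zero_smul, hΦ.map_one,
      show ((1 : ℝ), (0 : E3)) = (1, (0 : ℝ) • H e) by rw [zero_smul], tp_axis hHe] at h
    refine ⟨?_, ?_⟩
    · have := congrArg Prod.fst h
      simp only at this; linarith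
    · have := hcoef (congrArg Prod.snd h)
      linarith
  have hscale1 : scale Φ 1 = 1 := by simp [scale, hΦ.map_one]
  -- D = (c, s e) has eigenvalues k and k⁻¹, and E projects onto the k-eigenline, so DED = k²E.
  have hdil : ∀ k : ℝ, 0 < k → ∀ c s : ℝ, c = (k + k⁻¹) / 2 → s = (k - k⁻¹) / 2 →
      tp (c, s • H e) (x, y • H e) = (Φ (k ^ 2, 0)).1 • (x, y • H e) := by
    intro k hk c s hc hs
    have hcs : c ^ 2 - s ^ 2 = 1 := by
      rw [hc, hs]; field_simp; ring
    have hki : 0 < k⁻¹ := inv_pos.mpr hk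
    have hlt : |s| < c := by
      rw [abs_lt]; constructor <;> linarith
    have hD := hpd he hlt
    rw [hcs, hscale1, one_smul] at hD
    have hsum : c + s = k := by rw [hc, hs]; ring
    have hDE : tp (c, s • e) (1 / 2, (1 / 2 : ℝ) • e) = k ^ 2 • (1 / 2, (1 / 2 : ℝ) • e) := by
      rw [tp_axis he, ← hsum]
      ext1
      · simp only [Prod.smul_fst, smul_eq_mul]; ring
      · simp only [Prod.smul_snd, smul_smul]; congr 1; ring
    have h := congrArg Φ hDE
    rwa [hΦ.map_tp, hD, hΦ.map_smul (by positivity), hE e he] at h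
  by_cases hx0 : x = 0
  · right
    have hy0 : y = 0 := by have := hidem.2; rw [hx0] at this; linarith
    have hsing : ∀ n : E3, ‖n‖ = 1 → ∀ α β : ℝ, |β| = α → Φ (α, β • n) = 0 := by
      intro n hn α β h
      have hα : 0 ≤ α := h ▸ abs_nonneg β
      obtain ⟨m, hm, hmn⟩ : ∃ m : E3, ‖m‖ = 1 ∧ β • n = α • m := by
        rcases abs_choice β with h' | h'
        · exact ⟨n, hn, by rw [← h, h']⟩
        · exact ⟨-n, by rw [norm_neg, hn], by rw [← h, h']; module⟩
      have hA : (α, α • m) = (2 * α) • (1 / 2, (1 / 2 : ℝ) • m) := by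
        ext1
        · simp only [Prod.smul_fst, smul_eq_mul]; ring
        · simp only [Prod.smul_snd, smul_smul]; congr 1; ring
      rw [hmn, hA, hΦ.map_smul (by linarith), hE m hm, hx0, hy0, zero_smul]
      exact smul_zero _
    refine ⟨scale Φ, σ, ν, hσ, hν, ⟨fun t ht => hΦ.scale_pos ht, fun s t hs _ =>
      hΦ.scale_mul hs.le, fun A hA => ?_, fun A hA => ?_, fun A hA => ?_, fun A hA => ?_⟩⟩
    · obtain ⟨n, hn, -, α, β, hαβ, K, hK, hAK⟩ := exists_psd_conj A
      have hdK : |sdet K| = 1 := by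
        rcases hK with ⟨-, rfl⟩ | ⟨-, rfl⟩ | ⟨-, rfl⟩
        exacts [hd1, hdn1, hdJ n hn]
      have hd := congrArg sdet hAK
      rw [sdet_tp, sdet_axis hn, hA] at hd
      have hK0 : sdet K ≠ 0 := by
        intro h; rw [h, abs_zero] at hdK; exact zero_ne_one hdK
      have h2 := pow_eq_zero_iff two_ne_zero |>.mp ((mul_eq_zero.mp hd.symm).resolve_right hK0)
      have h3 : |β| = α := by
        have hα : 0 ≤ α := (abs_nonneg β).trans hαβ
        rw [← abs_of_nonneg hα, abs_eq_abs, ← sq_eq_sq_iff_eq_or_eq_neg]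
        linarith
      rw [hAK, hΦ.map_tp, hsing n hn α β h3]
      simp [tp, sdet]
    all_goals
      obtain ⟨n, hn, hAn, α, β, hαβ, K, hK, hAK⟩ := exists_psd_conj A
      have hu := norm_nonneg A.2
    · rcases hK with ⟨-, rfl⟩ | ⟨h, -⟩ | ⟨h, -⟩
      · have hdA : sdet A ≠ 0 := by simp only [sdet]; nlinarith
        have := hinv A hn α β 1 _ hαβ (hKform (Or.inl rfl)) hd1 hdA h1' hAK
        rwa [one_mul] at this
      · linarith
      · have := (abs_lt.mp h).2; linarith
    · rcases hK with ⟨h, -⟩ | ⟨h, -⟩ | ⟨-, rfl⟩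
      · have := (abs_lt.mp hA).2; linarith
      · have := (abs_lt.mp hA).1; linarith
      · have hdA : sdet A ≠ 0 := by
          have := (sq_lt_sq₀ (abs_nonneg _) hu).mpr hA
          rw [sq_abs] at this
          simp only [sdet]; linarith
        exact hinv A hn α β σ _ hαβ (hKform (Or.inr (Or.inr rfl))) (hdJ n hn) hdA (hJ' n hn) hAK
    · rcases hK with ⟨h, -⟩ | ⟨-, rfl⟩ | ⟨h, -⟩
      · linarith
      · have hdA : sdet A ≠ 0 := by simp only [sdet]; nlinarith
        exact hinv A hn α β ν _ hαβ (hKform (Or.inr (Or.inl rfl))) hdn1 hdA hN' hAK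
      · have := (abs_lt.mp h).1; linarith
  · left
    have hy0 : y ≠ 0 := by
      intro hy
      have hx1 : x = 1 := by
        have h1 := hidem.1
        rw [hy] at h1
        have h2 : x * (x - 1) = 0 := by linear_combination h1
        exact sub_eq_zero.mp ((mul_eq_zero.mp h2).resolve_left hx0)
      have h := hdil 2 (by norm_num) _ _ rfl rfl
      rw [tp_axis hHe, hx1, hy] at h
      have := hcoef (a := 2 * ((2 + 2⁻¹) / 2) * 1 * ((2 - 2⁻¹) / 2) + ((2 - 2⁻¹) / 2) ^ 2 * 0 +
        ((2 + 2⁻¹) / 2) ^ 2 * 0) (b := (Φ (2 ^ 2, 0)).1 * 0) (by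
          have := congrArg Prod.snd h
          simpa only [Prod.smul_mk, smul_smul] using this)
      norm_num at this
    have hx : x = 1 / 2 := by
      have h1 : y * (2 * x - 1) = 0 := by linear_combination hidem.2
      have := (mul_eq_zero.mp h1).resolve_left hy0
      linarith
    have hy2 : y ^ 2 = 1 / 4 := by have := hidem.1; rw [hx] at this; linarith
    have hhalf : (Φ (1 / 2, 0)).1 = 1 / 2 := by
      obtain ⟨m, hm, hem⟩ := exists_perp e
      have hEm : tp (1 / 2, (1 / 2 : ℝ) • e) (1 / 2, (1 / 2 : ℝ) • m) =
          (1 / 2 : ℝ) • (1 / 2, (1 / 2 : ℝ) • e) := by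
        simp only [tp, sdet_axis he, inner_smul_left, inner_smul_right, hem]
        ext1
        · simp only [Prod.smul_fst, smul_eq_mul]; norm_num
        · simp only [Prod.smul_snd, smul_smul]; module
      have h := congrArg Φ hEm
      rw [hΦ.map_tp, hΦ.map_smul (by norm_num), hE e he, hE m hm] at h
      have h2 := congrArg Prod.fst h
      simp only [tp, sdet_axis hHe, inner_smul_left, inner_smul_right, hH, hem, Prod.smul_fst,
        smul_eq_mul, hx, hy2] at h2
      linarith
    have hfour : (Φ (4, 0)).1 = 4 := by
      have h1 := hΦ.real_fst_mul (a := 1 / 2) (b := 4) (by norm_num)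
      have h2 := hΦ.real_fst_mul (a := 1 / 2) (b := 2) (by norm_num)
      rw [hhalf, show (1 : ℝ) / 2 * 4 = 2 by norm_num] at h1
      rw [hhalf, show (1 : ℝ) / 2 * 2 = 1 by norm_num, hΦ.map_one] at h2
      simp only at h2
      linarith
    -- Of the remaining values ±1/2, the negative one would scale by k⁻² instead of k²; k = 2
    -- decides.
    have hy : y = 1 / 2 := by
      have h := hdil 2 (by norm_num) _ _ rfl rfl
      rw [tp_axis hHe, show (2 : ℝ) ^ 2 = 4 by norm_num, hfour] at h
      have := congrArg Prod.fst h
      simp only [Prod.smul_fst, smul_eq_mul, hx] at this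
      linarith
    subst hx hy
    have hf : ∀ k : ℝ, 0 < k → (Φ (k ^ 2, 0)).1 = k ^ 2 := by
      intro k hk
      have h := hdil k hk _ _ rfl rfl
      rw [tp_axis hHe] at h
      have := congrArg Prod.fst h
      simp only [Prod.smul_fst, smul_eq_mul] at this
      linear_combination (-2) * this
    have hf' : ∀ a : ℝ, 0 ≤ a → (Φ (a, 0)).1 = a := by
      intro a ha
      rcases ha.eq_or_lt with rfl | ha
      · rw [hΦ.map_zero]
      · have := hf _ (Real.sqrt_pos.mpr ha)
        rwa [Real.sq_sqrt ha.le] at this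
    have hscale : ∀ t, 0 < t → scale Φ t = 1 := fun t ht => by
      rw [scale, hf' _ (Real.sqrt_nonneg t), div_self (Real.sqrt_pos.mpr ht).ne']
    have hpsd : ∀ n : E3, ‖n‖ = 1 → ∀ α β : ℝ, |β| ≤ α → Φ (α, β • n) = (1 : ℝ) • (α, β • H n) := by
      intro n hn α β hαβ
      rcases hαβ.lt_or_eq with h | h
      · rw [hpd hn h, hscale]
        have h0 := abs_nonneg β
        have := sq_abs β
        nlinarith
      · have hα : 0 ≤ α := h ▸ abs_nonneg β
        obtain ⟨m, hm, hmn, hHmn⟩ : ∃ m : E3, ‖m‖ = 1 ∧ β • n = α • m ∧ β • H n = α • H m := by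
          rcases abs_choice β with h' | h'
          · exact ⟨n, hn, by rw [← h, h'], by rw [← h, h']⟩
          · exact ⟨-n, by rw [norm_neg, hn], by rw [← h, h']; module, by
              rw [← h, h', hneg]; module⟩
        have hA : ∀ m : E3, (α, α • m) = (2 * α) • (1 / 2, (1 / 2 : ℝ) • m) := fun m => by
          ext1
          · simp only [Prod.smul_fst, smul_eq_mul]; ring
          · simp only [Prod.smul_snd, smul_smul]; congr 1; ring
        rw [hmn, hA, hΦ.map_smul (by linarith), hE m hm, hf' _ (by linarith), ← hA, hHmn, one_smul]
    have hσ1 : σ = 1 := by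
      have h1 : tp (1 / 2, (1 / 2 : ℝ) • e) (0, (1 : ℝ) • e) = (1 / 2, (1 / 2 : ℝ) • e) := by
        rw [tp_axis he]
        ext1
        · norm_num
        · simp only; congr 1; norm_num
      have h := hconj he (1 / 2) (1 / 2) 1 σ (0, (1 : ℝ) • e) ⟨0, 1, rfl⟩
        (hpsd e he _ _ (by norm_num)) (by rw [one_smul]; exact hJ' e he)
      rw [h1, hE e he] at h
      have := congrArg Prod.fst h
      simp only [vecMap, Prod.smul_fst, smul_eq_mul] at this
      linarith
    have hν1 : ν = 1 := by
      -- Compressed by E, both -1 and -e become -E, so ν = σ.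
      have h1 : tp (1 / 2, (1 / 2 : ℝ) • e) (-1, (0 : ℝ) • e) =
          tp (1 / 2, (1 / 2 : ℝ) • e) (0, (-1 : ℝ) • e) := by
        rw [tp_axis he, tp_axis he]
        ext1
        · norm_num
        · simp only; congr 1; norm_num
      have h2 := hconj he (1 / 2) (1 / 2) 1 ν (-1, (0 : ℝ) • e) ⟨-1, 0, rfl⟩
        (hpsd e he _ _ (by norm_num)) (by rw [zero_smul]; exact hN')
      have h3 := hconj he (1 / 2) (1 / 2) 1 σ (0, (-1 : ℝ) • e) ⟨0, -1, rfl⟩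
        (hpsd e he _ _ (by norm_num)) (by
          rw [neg_one_smul]; exact hJ' (-e) (by rw [norm_neg, he]))
      rw [← h1, h2, tp_axis he] at h3
      have := congrArg Prod.fst h3
      simp only [vecMap, Prod.smul_fst, smul_eq_mul] at this
      linarith
    intro A
    obtain ⟨n, hn, -, α, β, hαβ, K, hK, hAK⟩ := exists_psd_conj A
    have hK' : Φ K = (1 : ℝ) • vecMap H K := by
      rcases hK with ⟨-, rfl⟩ | ⟨-, rfl⟩ | ⟨-, rfl⟩
      · exact h1'
      · rw [hN', hν1]
      · rw [hJ' n hn, hσ1]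
    have hK2 : ∃ k m : ℝ, K = (k, m • n) := hKform (by
      rcases hK with ⟨-, h⟩ | ⟨-, h⟩ | ⟨-, h⟩
      exacts [Or.inl h, Or.inr (Or.inl h), Or.inr (Or.inr h)])
    have := hconj hn α β 1 1 K hK2 (hpsd n hn α β hαβ) hK'
    rw [← hAK] at this
    simpa using this

end SpinFactor

end

/-! ### Pauli coordinates and unitary implementation of isometries -/

noncomputable section

namespace JordanTriple

open SpinFactor
open scoped RealInnerProductSpace

/-- The Hermitian matrix with given scalar part and Pauli coordinates. -/
def toH (X : ℝ × E3) : H2 :=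
  ⟨!![((X.1 + X.2 2 : ℝ) : ℂ), ⟨X.2 0, -X.2 1⟩; ⟨X.2 0, X.2 1⟩, ((X.1 - X.2 2 : ℝ) : ℂ)], by
    ext i j
    fin_cases i <;> fin_cases j <;> apply Complex.ext <;> simp⟩

/-- The scalar part and the Pauli coordinates of a Hermitian matrix. -/
def ofH (A : H2) : ℝ × E3 :=
  (((A.1 0 0).re + (A.1 1 1).re) / 2,
    !₂[(A.1 1 0).re, (A.1 1 0).im, ((A.1 0 0).re - (A.1 1 1).re) / 2])

theorem ofH_toH (X : ℝ × E3) : ofH (toH X) = X := by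
  obtain ⟨a, u⟩ := X
  ext1
  · simp [ofH, toH]
  · ext i
    fin_cases i <;> simp [ofH, toH]

theorem toH_ofH (A : H2) : toH (ofH A) = A := by
  have h : ∀ i j, star (A.1 j i) = A.1 i j := fun i j => congrFun (congrFun A.2 i) j
  have h00 := congrArg Complex.im (h 0 0)
  have h11 := congrArg Complex.im (h 1 1)
  have h01 := h 0 1
  simp only [Complex.star_def, Complex.conj_im] at h00 h11
  apply Subtype.ext
  ext i j
  fin_cases i <;> fin_cases j
  · apply Complex.ext
    · simp [ofH, toH]; ring
    · simp [ofH, toH]; linarith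
  · simp only [ofH, toH, Fin.zero_eta, Fin.mk_one]
    rw [← h01]
    apply Complex.ext <;> simp
  · apply Complex.ext <;> simp [ofH, toH]
  · apply Complex.ext
    · simp [ofH, toH]; ring
    · simp [ofH, toH]; linarith

theorem sdet_eq_coord (a : ℝ) (u : E3) :
    sdet (a, u) = a * a - (u 0 * u 0 + u 1 * u 1 + u 2 * u 2) := by
  simp only [sdet, EuclideanSpace.real_norm_sq_eq, Fin.sum_univ_three]
  ring

theorem toH_tp (X Y : ℝ × E3) : toH (tp X Y) = triple (toH X) (toH Y) := by
  obtain ⟨a, u⟩ := X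
  obtain ⟨b, v⟩ := Y
  apply Subtype.ext
  ext i j
  fin_cases i <;> fin_cases j <;> apply Complex.ext <;>
    simp [toH, triple, tp, sdet_eq_coord, PiLp.inner_apply, Fin.sum_univ_three] <;> ring

theorem ofH_triple (A B : H2) : ofH (triple A B) = tp (ofH A) (ofH B) := by
  rw [← ofH_toH (tp (ofH A) (ofH B)), toH_tp, toH_ofH, toH_ofH]

theorem det_toH (X : ℝ × E3) : (toH X).1.det = (sdet X : ℂ) := by
  obtain ⟨a, u⟩ := X
  rw [Matrix.det_fin_two]
  apply Complex.ext <;>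
    simp [toH, sdet_eq_coord] <;> ring

theorem trace_toH (X : ℝ × E3) : (toH X).1.trace = ((2 * X.1 : ℝ) : ℂ) := by
  rw [Matrix.trace_fin_two]
  apply Complex.ext <;> simp [toH]
  ring

theorem rdet_toH (X : ℝ × E3) : rdet (toH X) = sdet X := by
  rw [rdet, det_toH, Complex.ofReal_re]

theorem toH_smul (c : ℝ) (X : ℝ × E3) : (toH (c • X)).1 = (c : ℂ) • (toH X).1 := by
  obtain ⟨a, u⟩ := X
  ext i j
  fin_cases i <;> fin_cases j <;> apply Complex.ext <;> simp [toH] <;> ring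

theorem toH_one : (toH (1, 0)).1 = 1 := by
  ext i j
  fin_cases i <;> fin_cases j <;> apply Complex.ext <;> simp [toH]

theorem toH_zero : (toH 0).1 = 0 := by
  ext i j
  fin_cases i <;> fin_cases j <;> apply Complex.ext <;> simp [toH]

/-- The half-turn about the axis `k`. -/
def halfturn (k u : E3) : E3 := (2 * ⟪k, u⟫) • k - u

theorem halfturn_halfturn {k : E3} (hk : ‖k‖ = 1) (u : E3) : halfturn k (halfturn k u) = u := by
  simp only [halfturn, inner_sub_right, inner_smul_right, real_inner_self_eq_norm_sq, hk]
  module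

theorem inner_halfturn {k : E3} (hk : ‖k‖ = 1) (u v : E3) :
    ⟪halfturn k u, halfturn k v⟫ = ⟪u, v⟫ := by
  simp only [halfturn, inner_sub_right, inner_sub_left, inner_smul_right, inner_smul_left,
    real_inner_self_eq_norm_sq, hk, conj_trivial]
  rw [real_inner_comm k u]
  ring

/-- The Hermitian unitary matrix of a unit vector. -/
abbrev pauli (k : E3) : Matrix (Fin 2) (Fin 2) ℂ := (toH (0, k)).1

theorem pauli_star (k : E3) : (pauli k)ᴴ = pauli k := (toH (0, k)).2

theorem pauli_mul_self {k : E3} (hk : ‖k‖ = 1) : pauli k * pauli k = 1 := by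
  have h := toH_tp (0, k) (1, 0)
  rw [tp_unit hk] at h
  have h' := congrArg Subtype.val h
  simp only [inner_zero_right, mul_zero, zero_smul, sub_zero, triple, toH_one, mul_one] at h'
  exact h'.symm

theorem pauli_mem {k : E3} (hk : ‖k‖ = 1) : pauli k ∈ Matrix.unitaryGroup (Fin 2) ℂ := by
  rw [Matrix.mem_unitaryGroup_iff, Matrix.star_eq_conjTranspose, pauli_star, pauli_mul_self hk]

theorem pauli_conj {k : E3} (hk : ‖k‖ = 1) (X : ℝ × E3) :
    (toH (vecMap (halfturn k) X)).1 = pauli k * (toH X).1 * pauli k := by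
  have h := toH_tp (0, k) X
  rw [tp_unit hk] at h
  exact congrArg Subtype.val h

/-- An inner product preserving map of `ℝ³` is induced by a unitary matrix, up to complex
conjugation. -/
theorem exists_unitary {H : E3 → E3} (hH : ∀ u v, ⟪H u, H v⟫ = ⟪u, v⟫) :
    ∃ U ∈ Matrix.unitaryGroup (Fin 2) ℂ,
      (∀ X, (toH (vecMap H X)).1 = U * (toH X).1 * Uᴴ) ∨
      (∀ X, (toH (vecMap H X)).1 = U * bar (toH X).1 * Uᴴ) := by
  set e : Fin 3 → E3 := fun i => EuclideanSpace.single i 1 with he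
  have hen : ∀ i, ‖e i‖ = 1 := fun i => by simp [he]
  have hcoord : ∀ (u : E3) i, ⟪e i, u⟫ = u i := fun u i => by
    simp [he, EuclideanSpace.inner_single_left]
  have hee : ∀ i j, i ≠ j → ⟪e i, e j⟫ = 0 := fun i j hij => by
    rw [hcoord]; simp [he, hij]
  -- The target is `-e 2` because the second half-turn, about an axis orthogonal to `e 2`, reverses
  -- it again.
  obtain ⟨k₁, hk₁, h₁⟩ := exists_halfturn (n := H (e 2)) (m := -e 2)
    (by rw [norm_of_inner_preserving hH, hen]) (by rw [norm_neg, hen])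
  set H₁ : E3 → E3 := fun u => halfturn k₁ (H u) with hH₁
  have hH₁i : ∀ u v, ⟪H₁ u, H₁ v⟫ = ⟪u, v⟫ := fun u v => by
    rw [hH₁]; simp only [inner_halfturn hk₁, hH]
  have h₁2 : H₁ (e 2) = -e 2 := h₁
  have h₁perp : ⟪H₁ (e 0), e 2⟫ = 0 := by
    have := hH₁i (e 0) (e 2)
    rw [h₁2, inner_neg_right, hee 0 2 (by decide)] at this
    linarith
  obtain ⟨k₂, hk₂, h₂, hk₂e⟩ : ∃ k : E3, ‖k‖ = 1 ∧ halfturn k (H₁ (e 0)) = e 0 ∧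
      ⟪k, e 2⟫ = 0 := by
    by_cases hop : H₁ (e 0) = -e 0
    · refine ⟨e 1, hen 1, ?_, hee 1 2 (by decide)⟩
      rw [hop, halfturn, inner_neg_right, hee 1 0 (by decide)]
      simp
    · obtain ⟨k, hk, h⟩ := exists_halfturn (n := H₁ (e 0)) (m := e 0)
        (by rw [norm_of_inner_preserving hH₁i, hen]) (hen 0)
      refine ⟨k, hk, h, ?_⟩
      have h3 := congrArg (fun w => ⟪w, e 2⟫) h
      simp only [inner_sub_left, inner_smul_left, h₁perp, hee 0 2 (by decide), conj_trivial] at h3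
      have h4 : ⟪k, H₁ (e 0)⟫ ≠ 0 := by
        intro h0
        rw [h0, mul_zero, zero_smul, zero_sub] at h
        exact hop (neg_eq_iff_eq_neg.mp h)
      rw [sub_zero] at h3
      exact (mul_eq_zero.mp h3).resolve_left (mul_ne_zero two_ne_zero h4)
  set H₂ : E3 → E3 := fun u => halfturn k₂ (H₁ u) with hH₂
  have hH₂i : ∀ u v, ⟪H₂ u, H₂ v⟫ = ⟪u, v⟫ := fun u v => by
    rw [hH₂]; simp only [inner_halfturn hk₂, hH₁i]
  have h20 : H₂ (e 0) = e 0 := h₂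
  have h22 : H₂ (e 2) = e 2 := by
    rw [hH₂]; simp only
    rw [h₁2, halfturn, inner_neg_right, hk₂e]
    simp
  set y := H₂ (e 1) 1 with hy
  have h21 : H₂ (e 1) = y • e 1 := by
    have c0 : H₂ (e 1) 0 = 0 := by
      rw [← hcoord, ← h20, hH₂i, hee 0 1 (by decide)]
    have c2 : H₂ (e 1) 2 = 0 := by
      rw [← hcoord, ← h22, hH₂i, hee 2 1 (by decide)]
    ext i
    fin_cases i
    · exact c0.trans (by simp [he])
    · simp [he, hy]
    · exact c2.trans (by simp [he])
  have hy2 : y * y = 1 := by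
    have := hH₂i (e 1) (e 1)
    rw [h21, inner_smul_left, inner_smul_right, real_inner_self_eq_norm_sq, hen] at this
    simpa using this
  have hform : ∀ u, H₂ u 0 = u 0 ∧ H₂ u 1 = y * u 1 ∧ H₂ u 2 = u 2 := by
    intro u
    refine ⟨?_, ?_, ?_⟩
    · rw [← hcoord, ← h20, hH₂i, hcoord]
    · have := hH₂i (e 1) u
      rw [h21, inner_smul_left, hcoord, hcoord, conj_trivial] at this
      rw [← this, ← mul_assoc, hy2, one_mul]
    · rw [← hcoord, ← h22, hH₂i, hcoord]
  have hHH : ∀ X, vecMap H X = vecMap (halfturn k₁) (vecMap (halfturn k₂) (vecMap H₂ X)) := by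
    intro X
    simp only [vecMap, hH₂, hH₁, halfturn_halfturn hk₂, halfturn_halfturn hk₁]
  have hconj : ∀ X, (toH (vecMap H X)).1 =
      (pauli k₁ * pauli k₂) * (toH (vecMap H₂ X)).1 * (pauli k₁ * pauli k₂)ᴴ := by
    intro X
    rw [hHH, pauli_conj hk₁, pauli_conj hk₂, Matrix.conjTranspose_mul, pauli_star, pauli_star]
    simp only [Matrix.mul_assoc]
  refine ⟨pauli k₁ * pauli k₂, mul_mem (pauli_mem hk₁) (pauli_mem hk₂), ?_⟩
  rcases mul_self_eq_one_iff.mp hy2 with h | h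
  · left
    intro X
    have : vecMap H₂ X = X := by
      ext1
      · rfl
      · ext i
        obtain ⟨f0, f1, f2⟩ := hform X.2
        fin_cases i
        · exact f0
        · exact f1.trans (by rw [h, one_mul]; rfl)
        · exact f2
    rw [hconj, this]
  · right
    intro X
    -- Only the second Pauli matrix is not real, so reversing that coordinate is entrywise
    -- conjugation.
    have : (toH (vecMap H₂ X)).1 = bar (toH X).1 := by
      obtain ⟨f0, f1, f2⟩ := hform X.2
      rw [h] at f1
      ext i j
      fin_cases i <;> fin_cases j <;> apply Complex.ext <;>
        simp [toH, vecMap, bar, f0, f1, f2]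
    rw [hconj, this]

end JordanTriple

end

/-! ### Inertia and real-valued homomorphisms -/

noncomputable section

namespace JordanTriple

open SpinFactor
open scoped RealInnerProductSpace

theorem card_subtype_fin_two (p : Fin 2 → Prop) [Decidable (p 0)] [Decidable (p 1)] :
    Nat.card {i : Fin 2 // p i} = (if p 0 then 1 else 0) + (if p 1 then 1 else 0) := by
  classical
  rw [Nat.card_eq_fintype_card, Fintype.card_subtype, Finset.card_filter, Fin.sum_univ_two]
  congr

theorem eigenvalues_toH (X : ℝ × E3) :
    (toH X).2.eigenvalues 0 + (toH X).2.eigenvalues 1 = 2 * X.1 ∧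
      (toH X).2.eigenvalues 0 * (toH X).2.eigenvalues 1 = sdet X := by
  constructor
  · have h := (toH X).2.trace_eq_sum_eigenvalues
    rw [trace_toH, Fin.sum_univ_two] at h
    refine Complex.ofReal_injective ?_
    rw [Complex.ofReal_add]
    exact h.symm
  · have h := (toH X).2.det_eq_prod_eigenvalues
    rw [det_toH, Fin.prod_univ_two] at h
    refine Complex.ofReal_injective ?_
    rw [Complex.ofReal_mul]
    exact h.symm

theorem inertia_posdef {X : ℝ × E3} (h : ‖X.2‖ < X.1) : inertia (toH X) = 2 := by
  classical
  obtain ⟨h1, h2⟩ := eigenvalues_toH X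
  have hu := norm_nonneg X.2
  have hd : 0 < sdet X := by simp only [sdet]; nlinarith
  apply Fin.ext
  simp only [inertia]
  rw [card_subtype_fin_two]
  generalize (toH X).2.eigenvalues 0 = x at *
  generalize (toH X).2.eigenvalues 1 = y at *
  have hx : 0 < x := by by_contra hx; nlinarith
  have hy : 0 < y := by by_contra hy; nlinarith
  simp [hx, hy]

theorem inertia_indef {X : ℝ × E3} (h : |X.1| < ‖X.2‖) : inertia (toH X) = 1 := by
  classical
  obtain ⟨h1, h2⟩ := eigenvalues_toH X
  have hd : sdet X < 0 := by
    have := (sq_lt_sq₀ (abs_nonneg _) (norm_nonneg _)).mpr h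
    rw [sq_abs] at this
    simp only [sdet]; linarith
  apply Fin.ext
  simp only [inertia]
  rw [card_subtype_fin_two]
  generalize (toH X).2.eigenvalues 0 = x at *
  generalize (toH X).2.eigenvalues 1 = y at *
  rcases lt_or_ge 0 x with hx | hx
  · have hy : ¬ 0 < y := fun hy => by nlinarith
    simp [hx, hy]
  · have hy : 0 < y := by by_contra hy; nlinarith
    simp [not_lt.mpr hx, hy]

theorem inertia_negdef {X : ℝ × E3} (h : X.1 < -‖X.2‖) : inertia (toH X) = 0 := by
  classical
  obtain ⟨h1, h2⟩ := eigenvalues_toH X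
  have hu := norm_nonneg X.2
  have hd : 0 < sdet X := by simp only [sdet]; nlinarith
  apply Fin.ext
  simp only [inertia]
  rw [card_subtype_fin_two]
  generalize (toH X).2.eigenvalues 0 = x at *
  generalize (toH X).2.eigenvalues 1 = y at *
  have hx : ¬ 0 < x := fun hx => by nlinarith
  have hy : ¬ 0 < y := fun hy => by nlinarith
  simp [hx, hy]

open scoped ComplexOrder in
theorem posDef_toH (X : ℝ × E3) : (toH X).1.PosDef ↔ ‖X.2‖ < X.1 := by
  rw [(toH X).2.posDef_iff_eigenvalues_pos, Fin.forall_fin_two]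
  obtain ⟨h1, h2⟩ := eigenvalues_toH X
  generalize (toH X).2.eigenvalues 0 = x at *
  generalize (toH X).2.eigenvalues 1 = y at *
  have hu := norm_nonneg X.2
  simp only [sdet] at h2
  constructor
  · rintro ⟨hx, hy⟩
    refine (abs_lt_of_sq_lt_sq' ?_ (by linarith)).2
    have := mul_pos hx hy
    linarith
  · intro h
    have : 0 < x * y := by rw [h2]; nlinarith
    constructor
    · by_contra hx; nlinarith
    · by_contra hy; nlinarith

theorem eta_toH (X : ℝ × E3) : eta (toH X) = if X.1 < -‖X.2‖ then -1 else 1 := by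
  have h : -(toH X).1 = (toH (-X)).1 := by
    have := toH_smul (-1) X
    rw [neg_one_smul] at this
    rw [this]; simp
  unfold eta
  rw [h]
  simp only [posDef_toH, Prod.snd_neg, Prod.fst_neg, norm_neg, lt_neg]

theorem sgn_one : sgn 1 = 1 := by simp [sgn]

theorem sgn_neg_one : sgn (-1) = -1 := by simp [sgn]

theorem sgn_mul_self (ε : ℤˣ) : sgn ε * sgn ε = 1 := by
  rcases Int.units_eq_one_or ε with rfl | rfl <;> simp [sgn]

theorem exists_sgn {x : ℝ} (h : x * x = 1) : ∃ ε : ℤˣ, sgn ε = x := by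
  rcases mul_self_eq_one_iff.mp h with rfl | rfl
  · exact ⟨1, by simp [sgn]⟩
  · exact ⟨-1, by simp [sgn]⟩

theorem nnnorm_det_toH (X : ℝ × E3) : ‖(toH X).1.det‖₊ = ⟨|sdet X|, abs_nonneg _⟩ := by
  apply NNReal.eq
  rw [det_toH, coe_nnnorm, Complex.norm_real, Real.norm_eq_abs]
  rfl

/-- Every real valued Jordan triple homomorphism is a function of `|det A|` and of the inertia. -/
theorem isScalarForm {φ : H2 → ℝ} (hφ : IsRealJTPHom φ) : IsScalarForm φ := by
  refine ⟨hφ, ?_⟩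
  suffices h : ∃ (ψ : ℝ≥0 →ₙ* ℂ) (η : Fin 3 → ℤˣ), ∀ X : ℝ × E3,
      (φ (toH X) : ℂ) = ψ ‖(toH X).1.det‖₊ * sgn (η (inertia (toH X))) by
    obtain ⟨ψ, η, h⟩ := h
    exact ⟨ψ, η, fun A => by have := h (ofH A); rwa [toH_ofH] at this⟩
  set g : ℝ × E3 → ℝ := fun X => φ (toH X) with hg
  have hgtp : ∀ X Y, g (tp X Y) = g X * g Y * g X := fun X Y => by
    simp only [hg]; rw [toH_tp, hφ]
  have hone : ∀ X, tp (1, 0) X = X := fun X => by rw [tp_real]; simp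
  by_cases hc : g (1, 0) = 0
  · refine ⟨⟨fun _ => 0, by simp⟩, fun _ => 1, fun X => ?_⟩
    have : g X = 0 := by rw [← hone X, hgtp, hc]; ring
    change ((g X : ℝ) : ℂ) = _
    rw [this]
    simp
  have hc2 : g (1, 0) * g (1, 0) = 1 := by
    have h1 := hgtp (1, 0) (1, 0)
    rw [hone] at h1
    have h2 : g (1, 0) * (g (1, 0) * g (1, 0) - 1) = 0 := by linear_combination -h1
    exact sub_eq_zero.mp ((mul_eq_zero.mp h2).resolve_left hc)
  obtain ⟨ε, hε⟩ := exists_sgn hc2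
  by_cases h0 : g (0, 0) = 0
  swap
  -- If `g (0, 0)` is nonzero, 0A0 = 0 makes g constant; ψ is then 1 everywhere, including at 0.
  · refine ⟨1, fun _ => ε, fun X => ?_⟩
    have hz : ∀ X, g (0, 0) * g X = 1 := fun X => by
      have h1 := hgtp (0, 0) X
      rw [tp_real] at h1
      simp only [ne_eq, OfNat.ofNat_ne_zero, not_false_eq_true, zero_pow, zero_mul, zero_smul] at h1
      have h2 : g (0, 0) * (g (0, 0) * g X - 1) = 0 := by linear_combination -h1
      exact sub_eq_zero.mp ((mul_eq_zero.mp h2).resolve_left h0)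
    have : g X = g (1, 0) := mul_left_cancel₀ h0 ((hz X).trans (hz _).symm)
    change ((g X : ℝ) : ℂ) = _
    rw [this]
    change _ = (1 : ℂ) * sgn ε
    rw [one_mul, hε]
  set h : ℝ × E3 → ℝ := fun X => g (1, 0) * g X with hh
  have hgh : ∀ X, g X = g (1, 0) * h X := fun X => by
    rw [hh]; linear_combination (-g X) * hc2
  have htp : ∀ X Y, h (tp X Y) = h X ^ 2 * h Y := fun X Y => by
    change g (1, 0) * g (tp X Y) = (g (1, 0) * g X) ^ 2 * (g (1, 0) * g Y)
    rw [hgtp]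
    linear_combination (-g (1, 0) * g X ^ 2 * g Y) * hc2
  have h1 : h (1, 0) = 1 := hc2
  have hzero : h (0, 0) = 0 := by rw [hh]; simp only [h0, mul_zero]
  have hsq1 : ∀ X, tp X (1, 0) = (1, 0) → h X ^ 2 = 1 := fun X hX => by
    have := htp X (1, 0)
    rw [hX, h1] at this
    linarith
  have hunit : ∀ n : E3, ‖n‖ = 1 → h (0, n) ^ 2 = 1 := fun n hn =>
    hsq1 _ (by rw [tp_unit hn]; simp)
  have hrot : ∀ n m : E3, ‖n‖ = 1 → ‖m‖ = 1 → ∀ a l : ℝ, h (a, l • n) = h (a, l • m) := by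
    intro n m hn hm a l
    obtain ⟨k, hk, hkn⟩ := exists_halfturn hn hm
    have hA : (a, l • m) = tp (0, k) (a, l • n) := by
      rw [tp_unit hk, ← hkn, inner_smul_right]
      ext1
      · rfl
      · simp only; module
    rw [hA, htp, hunit k hk, one_mul]
  obtain ⟨e, he, -⟩ := exists_perp 0
  -- P is h as a function of the eigenvalues. The unit vectors make h independent of the axis, so P
  -- is symmetric and, for nonnegative arguments, depends only on their product.
  set P : ℝ → ℝ → ℝ := fun x y => h ((x + y) / 2, ((x - y) / 2) • e) with hP
  have hPtp : ∀ x y z w, P (x ^ 2 * z) (y ^ 2 * w) = P x y ^ 2 * P z w := by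
    intro x y z w
    simp only [hP]
    rw [← htp, tp_axis he]
    congr 2
    · ring
    · congr 1; ring
  have hP1 : P 1 1 = 1 := by simp only [hP]; norm_num [h1]
  have hP0 : P 0 0 = 0 := by simp only [hP]; norm_num [hzero]
  have hPsq : ∀ x y, P (x ^ 2) (y ^ 2) = P x y ^ 2 := fun x y => by
    have := hPtp x y 1 1
    rwa [hP1, mul_one, mul_one, mul_one] at this
  have hPmul : ∀ x y z w, 0 ≤ x → 0 ≤ y → P (x * z) (y * w) = P x y * P z w := by
    intro x y z w hx hy
    have h2 := hPtp (√x) (√y) z w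
    have h3 := hPsq (√x) (√y)
    rw [Real.sq_sqrt hx, Real.sq_sqrt hy] at h2 h3
    rw [h2, h3]
  have hPswap : ∀ x y, P x y = P y x := by
    intro x y
    simp only [hP]
    rw [hrot e (-e) he (by rw [norm_neg, he])]
    congr 2
    · ring
    · module
  have hPprod : ∀ x y, 0 ≤ x → 0 ≤ y → P x y = P (x * y) 1 := by
    intro x y hx hy
    have h2 := hPmul x 1 1 y hx zero_le_one
    have h3 := hPmul x 1 y 1 hx zero_le_one
    rw [mul_one, one_mul] at h2
    rw [mul_one] at h3
    rw [h2, h3, hPswap 1 y]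
  let ψ : ℝ≥0 →ₙ* ℂ :=
    { toFun := fun t => ((P t 1 : ℝ) : ℂ)
      map_mul' := fun s t => by
        have := hPmul s 1 t 1 s.2 zero_le_one
        rw [mul_one] at this
        rw [NNReal.coe_mul, this, Complex.ofReal_mul] }
  obtain ⟨δ, hδ⟩ := exists_sgn (x := h (0, e)) (by rw [← pow_two, hunit e he])
  obtain ⟨ω, hω⟩ := exists_sgn (x := h (-1, 0)) (by
    rw [← pow_two]; exact hsq1 _ (by rw [tp_real]; simp))
  have hdecomp : ∀ X : ℝ × E3, ∃ ζ : ℤˣ, h X = P |sdet X| 1 * (sgn ζ).re ∧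
      ((‖X.2‖ ≤ X.1 ∧ ζ = 1) ∨ (X.1 ≤ -‖X.2‖ ∧ ζ = ω) ∨ (|X.1| < ‖X.2‖ ∧ ζ = δ)) := by
    intro X
    obtain ⟨n, hn, -, α, β, hαβ, K, hK, hA⟩ := exists_psd_conj X
    obtain ⟨hb1, hb2⟩ := abs_le.mp hαβ
    have hS : h (α, β • n) = P (α ^ 2 - β ^ 2) 1 := by
      rw [hrot n e hn he, show α ^ 2 - β ^ 2 = (α + β) * (α - β) by ring,
        ← hPprod _ _ (by linarith) (by linarith)]
      simp only [hP]
      congr 2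
      · ring
      · congr 1; ring
    have hnn : 0 ≤ α ^ 2 - β ^ 2 := by nlinarith
    have hd := congrArg sdet hA
    rw [sdet_tp, sdet_axis hn] at hd
    have hdK : |sdet K| = 1 := by
      rcases hK with ⟨-, rfl⟩ | ⟨-, rfl⟩ | ⟨-, rfl⟩
      · simp [sdet]
      · simp [sdet]
      · simp [sdet, hn]
    have hX : h X = P |sdet X| 1 * h K := by
      have h4 := hPsq (α ^ 2 - β ^ 2) 1
      rw [one_pow] at h4
      rw [hd, abs_mul, hdK, mul_one, abs_of_nonneg (by positivity), h4, ← hS, ← htp, ← hA]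
    rcases hK with ⟨hK, rfl⟩ | ⟨hK, rfl⟩ | ⟨hK, rfl⟩
    · exact ⟨1, by rw [hX, h1, sgn_one, Complex.one_re], Or.inl ⟨hK, rfl⟩⟩
    · exact ⟨ω, by rw [hX, hω, Complex.ofReal_re], Or.inr (Or.inl ⟨hK, rfl⟩)⟩
    · refine ⟨δ, ?_, Or.inr (Or.inr ⟨hK, rfl⟩)⟩
      have := hrot n e hn he 0 1
      rw [one_smul, one_smul] at this
      rw [hX, this, hδ, Complex.ofReal_re]
  have hsgn : ∀ ζ : ℤˣ, (((sgn ζ).re : ℝ) : ℂ) = sgn ζ := fun ζ => by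
    rcases Int.units_eq_one_or ζ with rfl | rfl <;> simp [sgn]
  have hsgnmul : ∀ a b : ℤˣ, sgn (a * b) = sgn a * sgn b := fun a b => by simp [sgn]
  -- Inertia 0, 1, 2 means negative definite, indefinite, positive definite for invertible elements;
  -- on singular ones ψ vanishes and the sign is irrelevant.
  refine ⟨ψ, ![ε * ω, ε * δ, ε], fun X => ?_⟩
  change ((g X : ℝ) : ℂ) = ((P (‖(toH X).1.det‖₊ : ℝ) 1 : ℝ) : ℂ) * _
  rw [nnnorm_det_toH]
  change ((g X : ℝ) : ℂ) = ((P |sdet X| 1 : ℝ) : ℂ) * _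
  obtain ⟨ζ, hζ, hcase⟩ := hdecomp X
  rw [hgh, hζ, Complex.ofReal_mul, Complex.ofReal_mul, hsgn, ← hε]
  by_cases hs : sdet X = 0
  · have : P |sdet X| 1 = 0 := by
      have h5 := hPmul 0 1 1 0 le_rfl zero_le_one
      rw [zero_mul, mul_zero, hP0, hPswap 1 0] at h5
      rw [hs, abs_zero]
      exact mul_self_eq_zero.mp h5.symm
    rw [this]; simp
  · have hne : X.1 ^ 2 ≠ ‖X.2‖ ^ 2 := fun h => hs (by simp only [sdet]; linarith)
    rcases hcase with ⟨hK, rfl⟩ | ⟨hK, rfl⟩ | ⟨hK, rfl⟩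
    · have hlt : ‖X.2‖ < X.1 := lt_of_le_of_ne hK fun h => hne (by rw [h])
      rw [inertia_posdef hlt, sgn_one]
      simp only [Matrix.cons_val]
      ring
    · have hlt : X.1 < -‖X.2‖ := lt_of_le_of_ne hK fun h => hne (by rw [h]; ring)
      rw [inertia_negdef hlt]
      simp only [Matrix.cons_val, hsgnmul]
      ring
    · rw [inertia_indef hK]
      simp only [Matrix.cons_val, hsgnmul]
      ring

end JordanTriple

end

/-! ### The four forms: verification and assembly -/

noncomputable section

namespace JordanTriple

open SpinFactor
open scoped RealInnerProductSpace

theorem rank_eq_two_iff (A : H2) : A.1.rank = 2 ↔ A.1.det ≠ 0 := by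
  constructor
  · intro h hd
    exact rdet_ne_zero A h (by rw [rdet, hd, Complex.zero_re])
  · intro h
    rw [Matrix.rank_of_isUnit _ ((Matrix.isUnit_iff_isUnit_det _).mpr h.isUnit), Fintype.card_fin]

theorem rank_le_one_iff (A : H2) : A.1.rank ≤ 1 ↔ A.1.det = 0 := by
  have h := A.1.rank_le_width
  constructor
  · intro hr
    by_contra hd
    have := (rank_eq_two_iff A).mpr hd
    omega
  · intro hd
    have : A.1.rank ≠ 2 := fun h2 => (rank_eq_two_iff A).mp h2 hd
    omega

theorem det_triple (A B : H2) : (triple A B).1.det = A.1.det * B.1.det * A.1.det := by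
  simp only [triple, Matrix.det_mul]

theorem detUnit_triple {A B : H2} (hA : A.1.rank = 2) (hB : B.1.rank = 2)
    (h : (triple A B).1.rank = 2) :
    detUnit (triple A B) h = detUnit A hA * detUnit B hB * detUnit A hA := by
  apply Units.ext
  change rdet (triple A B) = rdet A * rdet B * rdet A
  apply Complex.ofReal_injective
  rw [Complex.ofReal_mul, Complex.ofReal_mul, coe_rdet, coe_rdet, coe_rdet, det_triple]

open scoped ComplexOrder in
-- For invertible Hermitian A, ABA is a congruence of B, which preserves definiteness.
theorem eta_triple {A : H2} (hA : A.1.rank = 2) (B : H2) : eta (triple A B) = eta B := by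
  have hu : IsUnit A.1 :=
    (Matrix.isUnit_iff_isUnit_det _).mpr ((rank_eq_two_iff A).mp hA).isUnit
  have h : -(triple A B).1 = star A.1 * (-B.1) * A.1 := by
    have : star A.1 = A.1 := A.2
    rw [this]
    simp [triple]
  have hiff : (-(triple A B).1).PosDef ↔ (-B.1).PosDef := by
    rw [h]
    exact Matrix.IsUnit.posDef_star_left_conjugate_iff hu
  by_cases hp : (-B.1).PosDef
  · rw [eta, eta, if_pos (hiff.mpr hp), if_pos hp]
  · rw [eta, eta, if_neg (hiff.not.mpr hp), if_neg hp]

theorem bar_mul (M N : Matrix (Fin 2) (Fin 2) ℂ) : bar (M * N) = bar M * bar N :=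
  Matrix.map_mul

theorem IsTildeForm.map_triple {T : H2 → Matrix (Fin 2) (Fin 2) ℂ} (hT : IsTildeForm T) {A : H2}
    (hA : A.1.rank = 2) (B : H2) : T (triple A B) = T A * T B * T A := by
  have hs : ∀ X Y : Matrix (Fin 2) (Fin 2) ℂ, sgn (eta (triple A B)) • (X * Y * X) =
      (sgn (eta A) • X) * (sgn (eta B) • Y) * (sgn (eta A) • X) := by
    intro X Y
    rw [eta_triple hA]
    simp only [smul_mul_assoc, mul_smul_comm, smul_smul]
    congr 1
    linear_combination (-sgn (eta B)) * sgn_mul_self (eta A)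
  have hi : ∀ X Y : Matrix (Fin 2) (Fin 2) ℂ, (X * Y * X)⁻¹ = X⁻¹ * Y⁻¹ * X⁻¹ := by
    intro X Y
    rw [Matrix.mul_inv_rev, Matrix.mul_inv_rev, Matrix.mul_assoc]
  cases hT <;> simp only [← hs] <;> simp only [triple, bar_mul, hi]

theorem conj_triple {U : Matrix (Fin 2) (Fin 2) ℂ} (hU : U ∈ Matrix.unitaryGroup (Fin 2) ℂ)
    (X Y : Matrix (Fin 2) (Fin 2) ℂ) :
    (U * X * Uᴴ) * (U * Y * Uᴴ) * (U * X * Uᴴ) = U * (X * Y * X) * Uᴴ := by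
  have hU' : Uᴴ * U = 1 := Matrix.mem_unitaryGroup_iff'.mp hU
  have h : ∀ Z, Uᴴ * (U * Z) = Z := fun Z => by rw [← Matrix.mul_assoc, hU', Matrix.one_mul]
  simp only [Matrix.mul_assoc, h]

theorem sgn_conj_triple {U : Matrix (Fin 2) (Fin 2) ℂ} (hU : U ∈ Matrix.unitaryGroup (Fin 2) ℂ)
    (ε : ℤˣ) (X Y : Matrix (Fin 2) (Fin 2) ℂ) :
    (sgn ε • (U * X * Uᴴ)) * (sgn ε • (U * Y * Uᴴ)) * (sgn ε • (U * X * Uᴴ)) =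
      sgn ε • (U * (X * Y * X) * Uᴴ) := by
  simp only [smul_mul_assoc, mul_smul_comm, smul_smul, conj_triple hU]
  rw [sgn_mul_self, mul_one]

theorem FormI.isJTPHom {Φ : H2 → H2} {U : Matrix (Fin 2) (Fin 2) ℂ}
    (hU : U ∈ Matrix.unitaryGroup (Fin 2) ℂ) (h : FormI Φ U) : IsJTPHom Φ := by
  obtain ⟨φ₁, φ₂, ⟨h₁, -⟩, ⟨h₂, -⟩, h⟩ := h
  intro A B
  apply Subtype.ext
  change _ = (Φ A).1 * (Φ B).1 * (Φ A).1
  rw [h, h, h, conj_triple hU, h₁, h₂]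
  simp

theorem FormII.isJTPHom {Φ : H2 → H2} {U : Matrix (Fin 2) (Fin 2) ℂ}
    (hU : U ∈ Matrix.unitaryGroup (Fin 2) ℂ) (h : FormII Φ U) : IsJTPHom Φ := by
  obtain ⟨ε, h⟩ := h
  intro A B
  apply Subtype.ext
  change _ = (Φ A).1 * (Φ B).1 * (Φ A).1
  rw [h, h, h, sgn_conj_triple hU]
  rfl

theorem FormIII.isJTPHom {Φ : H2 → H2} {U : Matrix (Fin 2) (Fin 2) ℂ}
    (hU : U ∈ Matrix.unitaryGroup (Fin 2) ℂ) (h : FormIII Φ U) : IsJTPHom Φ := by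
  obtain ⟨ε, h⟩ := h
  intro A B
  apply Subtype.ext
  change _ = (Φ A).1 * (Φ B).1 * (Φ A).1
  rw [(h _).1, (h _).1, (h _).1, sgn_conj_triple hU, ← bar_mul, ← bar_mul]
  rfl

theorem FormIV.isJTPHom {Φ : H2 → H2} {U : Matrix (Fin 2) (Fin 2) ℂ}
    (hU : U ∈ Matrix.unitaryGroup (Fin 2) ℂ) (h : FormIV Φ U) : IsJTPHom Φ := by
  obtain ⟨ε, β, T, hT, h2, h1⟩ := h
  intro A B
  apply Subtype.ext
  change _ = (Φ A).1 * (Φ B).1 * (Φ A).1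
  by_cases hA : A.1.det = 0
  · rw [h1 A ((rank_le_one_iff A).mpr hA), h1 _ ((rank_le_one_iff _).mpr (by
      rw [det_triple, hA, mul_zero]))]
    simp
  by_cases hB : B.1.det = 0
  · rw [h1 B ((rank_le_one_iff B).mpr hB), h1 _ ((rank_le_one_iff _).mpr (by
      rw [det_triple, hB, mul_zero, zero_mul]))]
    simp
  have hAB : (triple A B).1.det ≠ 0 := by
    rw [det_triple]
    exact mul_ne_zero (mul_ne_zero hA hB) hA
  rw [← ne_eq, ← rank_eq_two_iff] at hA hB
  rw [← rank_eq_two_iff] at hAB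
  rw [h2 A hA, h2 B hB, h2 _ hAB, detUnit_triple hA hB hAB, hT.map_triple hA]
  simp only [smul_mul_assoc, mul_smul_comm, smul_smul, conj_triple hU]
  congr 1
  simp only [map_mul, Units.val_mul, Complex.ofReal_mul]
  linear_combination (-sgn ε * (β (detUnit A hA) : ℝ) ^ 2 * (β (detUnit B hB) : ℝ)) *
    sgn_mul_self ε

/-- The half-turn exchanging the common axis with the third Pauli axis diagonalises every value. The
entries a ± l are multiplicative on triple products because values with a common axis commute. -/
theorem exists_formI {Φ : H2 → H2} (hΦ : IsJTPHom Φ)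
    (h : HasAxis fun X => ofH (Φ (toH X))) :
    ∃ U ∈ Matrix.unitaryGroup (Fin 2) ℂ, FormI Φ U := by
  obtain ⟨e, he, h⟩ := h
  set p : E3 := EuclideanSpace.single 2 1 with hp
  have hpn : ‖p‖ = 1 := by simp [hp]
  obtain ⟨k, hk, hke⟩ := exists_halfturn hpn he
  have hc : ∀ A, ofH (Φ A) = ((ofH (Φ A)).1, ⟪e, (ofH (Φ A)).2⟫ • e) := by
    intro A
    obtain ⟨c, hc⟩ := h (ofH A)
    simp only [toH_ofH] at hc
    ext1
    · rfl
    · simp only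
      rw [hc, inner_smul_right, real_inner_self_eq_norm_sq, he]
      simp
  have hmul : ∀ A B, ofH (Φ (triple A B)) = tp (ofH (Φ A)) (ofH (Φ B)) := fun A B => by
    rw [hΦ, ofH_triple]
  have hform : ∀ s : ℝ, s * s = 1 →
      IsScalarForm fun A => (ofH (Φ A)).1 + s * ⟪e, (ofH (Φ A)).2⟫ := by
    intro s hs
    refine isScalarForm fun A B => ?_
    rw [hmul, hc A, hc B, tp_axis he]
    simp only [inner_smul_right, real_inner_self_eq_norm_sq, he]
    generalize (ofH (Φ A)).1 = a
    generalize ⟪e, (ofH (Φ A)).2⟫ = l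
    generalize (ofH (Φ B)).1 = b
    generalize ⟪e, (ofH (Φ B)).2⟫ = m
    linear_combination (-(2 * a * l * m + b * l ^ 2 + s * l ^ 2 * m)) * hs
  refine ⟨pauli k, pauli_mem hk, _, _, hform 1 (by norm_num), hform (-1) (by norm_num),
    fun A => ?_⟩
  have h1 : (Φ A).1 = (toH (vecMap (halfturn k) ((ofH (Φ A)).1, ⟪e, (ofH (Φ A)).2⟫ • p))).1 := by
    rw [← toH_ofH (Φ A), ofH_toH]
    congr 2
    nth_rewrite 1 [hc A]
    rw [vecMap, halfturn, inner_smul_right]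
    ext1
    · rfl
    · simp only
      rw [← hke]
      module
  rw [h1, pauli_conj hk, pauli_star]
  congr 2
  generalize (ofH (Φ A)).1 = a
  generalize ⟪e, (ofH (Φ A)).2⟫ = l
  ext i j
  fin_cases i <;> fin_cases j <;> apply Complex.ext <;> simp [toH, hp, sub_eq_add_neg]

/-- The multiplicative function `t ↦ f |t|` on `ℝ*`, multiplied by `σ` at negative numbers. -/
def absChar (f : ℝ → ℝ) (hpos : ∀ t, 0 < t → 0 < f t)
    (hmul : ∀ s t, 0 < s → 0 < t → f (s * t) = f s * f t) (σ : ℝ) (hσ : σ = 1 ∨ σ = -1) :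
    ℝˣ →* ℝˣ :=
  MonoidHom.mk' (fun t => Units.mk0 ((if 0 < (t : ℝ) then 1 else σ) * f |(t : ℝ)|) (by
      have h1 := (hpos _ (abs_pos.mpr t.ne_zero)).ne'
      split_ifs
      · rwa [one_mul]
      · rcases hσ with rfl | rfl
        · rwa [one_mul]
        · exact mul_ne_zero (by norm_num) h1)) (by
    intro s t
    apply Units.ext
    simp only [Units.val_mk0, Units.val_mul]
    rw [abs_mul, hmul _ _ (abs_pos.mpr s.ne_zero) (abs_pos.mpr t.ne_zero)]
    have hσ2 : σ * σ = 1 := by rcases hσ with rfl | rfl <;> norm_num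
    rcases lt_or_gt_of_ne s.ne_zero with hs | hs <;> rcases lt_or_gt_of_ne t.ne_zero with ht | ht
    · rw [if_pos (mul_pos_of_neg_of_neg hs ht), if_neg hs.not_gt, if_neg ht.not_gt]
      linear_combination (-f |(s : ℝ)| * f |(t : ℝ)|) * hσ2
    · rw [if_neg (mul_neg_of_neg_of_pos hs ht).not_gt, if_neg hs.not_gt, if_pos ht]
      ring
    · rw [if_neg (mul_neg_of_pos_of_neg hs ht).not_gt, if_neg ht.not_gt, if_pos hs]
      ring
    · rw [if_pos (mul_pos hs ht), if_pos hs, if_pos ht]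
      ring)

/-- The sign σ on indefinite elements is a sign at negative determinant and goes into β; the sign ν
on negative definite ones cannot be seen by the determinant and becomes η. -/
theorem exists_formIV {Φ : H2 → H2} {Ψ : ℝ × E3 → ℝ × E3} {H : E3 → E3} {f : ℝ → ℝ} {σ ν : ℝ}
    {ε : ℤˣ} (hΦ : ∀ X, (Φ (toH X)).1 = sgn ε • (toH (Ψ X)).1)
    (hΨ : IsSingularVanishing Ψ H f σ ν) (hσ : σ = 1 ∨ σ = -1) (hν : ν = 1 ∨ ν = -1)
    {U : Matrix (Fin 2) (Fin 2) ℂ} {V : Matrix (Fin 2) (Fin 2) ℂ → Matrix (Fin 2) (Fin 2) ℂ}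
    (hH : ∀ X, (toH (vecMap H X)).1 = U * V (toH X).1 * Uᴴ)
    (hV : IsTildeForm fun A => V A.1) (hVη : IsTildeForm fun A => sgn (eta A) • V A.1) :
    FormIV Φ U := by
  have hsing : ∀ A : H2, A.1.rank ≤ 1 → (Φ A).1 = 0 := by
    intro A hA
    rw [rank_le_one_iff, ← toH_ofH A, det_toH] at hA
    rw [← toH_ofH A, hΦ, hΨ.singular _ (by exact_mod_cast hA), toH_zero, smul_zero]
  have key : ∀ X : ℝ × E3, sdet X ≠ 0 → Ψ X =
      ((if X.1 < -‖X.2‖ then ν else 1) * ((if 0 < sdet X then 1 else σ) * f |sdet X|)) •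
        vecMap H X := by
    intro X hX
    have hu := norm_nonneg X.2
    rcases lt_trichotomy (sdet X) 0 with h | h | h
    · have hlt : |X.1| < ‖X.2‖ := by
        refine abs_lt_of_sq_lt_sq ?_ hu
        simp only [sdet] at h; linarith
      have h1 := (abs_lt.mp hlt).1
      rw [hΨ.indef X hlt, if_neg h1.not_gt, if_neg h.not_gt, one_mul]
    · exact absurd h hX
    · rw [if_pos h, one_mul]
      simp only [sdet] at h
      have hsq : ‖X.2‖ ^ 2 < |X.1| ^ 2 := by rw [sq_abs]; linarith
      have hlt := (sq_lt_sq₀ hu (abs_nonneg _)).mp hsq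
      rcases lt_abs.mp hlt with h2 | h2
      · rw [hΨ.posdef X h2, if_neg (by linarith), one_mul]
      · have h3 : X.1 < -‖X.2‖ := by linarith
        rw [hΨ.negdef X h3, if_pos h3]
  have hval : ∀ (A : H2) (h : A.1.rank = 2), (Φ A).1 =
      (sgn ε * ((if (ofH A).1 < -‖(ofH A).2‖ then ν else 1 : ℝ) *
        (absChar f hΨ.pos hΨ.mul σ hσ (detUnit A h) : ℝ) : ℝ)) • (U * V A.1 * Uᴴ) := by
    intro A h
    have hd : sdet (ofH A) = rdet A := by rw [← rdet_toH, toH_ofH]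
    have hne : sdet (ofH A) ≠ 0 := by rw [hd]; exact rdet_ne_zero A h
    have h1 := hΦ (ofH A)
    rw [key _ hne, toH_smul, hH, toH_ofH, smul_smul, hd] at h1
    exact h1
  rcases hν with rfl | rfl
  · refine ⟨ε, absChar f hΨ.pos hΨ.mul σ hσ, _, hV, fun A h => ?_, hsing⟩
    rw [hval A h, ite_self, one_mul]
  · refine ⟨ε, absChar f hΨ.pos hΨ.mul σ hσ, _, hVη, fun A h => ?_, hsing⟩
    have he := eta_toH (ofH A)
    rw [toH_ofH] at he
    rw [hval A h, mul_smul_comm, smul_mul_assoc, smul_smul, he]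
    congr 1
    split_ifs
    · rw [sgn_neg_one]; push_cast; ring
    · rw [sgn_one]; push_cast; ring

theorem bar_eq_transpose (A : H2) : bar A.1 = A.1ᵀ := by
  have h : A.1ᴴᵀ = A.1ᵀ := congrArg Matrix.transpose A.2
  rw [← h]
  rfl

theorem exists_form {Φ : H2 → H2} (hΦ : IsJTPHom Φ) :
    ∃ U ∈ Matrix.unitaryGroup (Fin 2) ℂ,
      FormI Φ U ∨ FormII Φ U ∨ FormIII Φ U ∨ FormIV Φ U := by
  set Φ' : ℝ × E3 → ℝ × E3 := fun X => ofH (Φ (toH X)) with hΦ'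
  by_cases hax : HasAxis Φ'
  · obtain ⟨U, hU, h⟩ := exists_formI hΦ hax
    exact ⟨U, hU, Or.inl h⟩
  have hhom : IsHom Φ' := fun X Y => by
    simp only [hΦ', toH_tp, hΦ (toH X), ofH_triple]
  obtain ⟨ε, Ψ, hΨ, hε⟩ : ∃ (ε : ℤˣ) (Ψ : ℝ × E3 → ℝ × E3), IsNonaxialHom Ψ ∧
      ∀ X, (Φ (toH X)).1 = sgn ε • (toH (Ψ X)).1 := by
    rcases (hhom.hasAxis_or_scalar).resolve_left hax with h | h
    · exact ⟨1, Φ', ⟨hhom, h, hax⟩, fun X => by rw [sgn_one, one_smul, hΦ', toH_ofH]⟩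
    -- The triple product is odd in the pair of its arguments, so -Φ' is again a homomorphism, now
    -- unital.
    · refine ⟨-1, fun X => (-1 : ℝ) • Φ' X, ⟨fun X Y => ?_, ?_, ?_⟩, fun X => ?_⟩
      · beta_reduce
        rw [tp_smul_smul, hhom]
        norm_num
      · beta_reduce
        rw [h]; simp
      · rintro ⟨e, he, hc⟩
        refine hax ⟨e, he, fun A => ?_⟩
        obtain ⟨c, hc⟩ := hc A
        refine ⟨-c, ?_⟩
        simp only [neg_one_smul, Prod.snd_neg] at hc
        rw [neg_smul, ← hc, neg_neg]
      · rw [toH_smul, smul_smul, sgn_neg_one, hΦ', toH_ofH]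
        simp
  obtain ⟨H, hH, hcase⟩ := hΨ.classification
  obtain ⟨U, hU, hUH⟩ := exists_unitary hH
  refine ⟨U, hU, Or.inr ?_⟩
  rcases hcase with hcase | ⟨f, σ, ν, hσ, hν, hcase⟩
  · rcases hUH with hUH | hUH
    · left
      refine ⟨ε, fun A => ?_⟩
      have := hε (ofH A)
      rwa [hcase, hUH, toH_ofH] at this
    · right; left
      refine ⟨ε, fun A => ?_⟩
      have := hε (ofH A)
      rw [hcase, hUH, toH_ofH] at this
      refine ⟨this, ?_⟩
      rw [this, bar_eq_transpose]
  · right; right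
    rcases hUH with hUH | hUH
    · exact exists_formIV (V := fun M => M) hε hcase hσ hν hUH IsTildeForm.id IsTildeForm.etaId
    · exact exists_formIV (V := bar) hε hcase hσ hν hUH IsTildeForm.conj IsTildeForm.etaConj

end JordanTriple

end

theorem theorem1 (Φ : JordanTriple.H2 → JordanTriple.H2) :
    JordanTriple.IsJTPHom Φ ↔
      ∃ U ∈ Matrix.unitaryGroup (Fin 2) ℂ,
        JordanTriple.FormI Φ U ∨ JordanTriple.FormII Φ U ∨
          JordanTriple.FormIII Φ U ∨ JordanTriple.FormIV Φ U := by
  constructor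
  · exact JordanTriple.exists_form
  · rintro ⟨U, hU, h | h | h | h⟩
    · exact h.isJTPHom hU
    · exact h.isJTPHom hU
    · exact h.isJTPHom hU
    · exact h.isJTPHom hU
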